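/- Let $G$ be a totally disconnected locally compact Hausdorff group and let $\mathbb{K}$ be a non-Archimedean valued field (possibly trivially valued) that is spherically complete: every decreasing sequence of balls in $\mathbb{K}$ has nonempty intersection. Let $\mathbb{K}_0$ be the closure in $\mathbb{K}$ of its prime field, with the restricted norm. For a non-Archimedean valued field $\mathbb{L}$, let $C_b(G,\mathbb{L})$ be the space of bounded continuous functions $G\to\mathbb{L}$ with the supremum norm, on which $G$ acts by $(g\cdot f)(x)=f(g^{-1}x)$. A left-invariant normed $\mathbb{L}$-mean on $G$ is a bounded linear map $m:C_b(G,\mathbb{L})\to\mathbb{L}$ with $m(\mathbf{1}_G)=1$ and $m(g\cdot f)=m(f)$ for all $g\in G$, $f\in C_b(G,\mathbb{L})$; its norm is $\inf\{C\ge 0 : |m(f)|\le C\|f\|_\infty \text{ for all } f\}$. The group $G$ is normed $\mathbb{L}$-amenable if such a mean exists; $\|G\|_{\mathbb{L}}\in[1,\infty]$ is the infimum of the norms of all such means ($\infty$ if there are none), and $G$ is $\mathbb{L}$-amenable of norm $\|G\|_{\mathbb{L}}$ when it is normed $\mathbb{L}$-amenable. The group $G$ is locally elliptic if it is a directed union of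 compact open subgroups. For an integer $n\ge 1$, $G$ is $n$-free if $n\nmid [U:V]$ for all open subgroups $V\le U\le G$ of finite index $[U:V]$; it is $n^{\mathbb{N}}$-free if it is $n^k$-free for some $k\ge 1$. Theorem. $G$ is normed $\mathbb{K}$-amenable if and only if it is normed $\mathbb{K}_0$-amenable, and $\|G\|_{\mathbb{K}}=\|G\|_{\mathbb{K}_0}$. More precisely, for every prime $p$: 1. If $\mathbb{K}_0\cong\mathbb{F}_p$, then the following are equivalent: $G$ is normed $\mathbb{K}$-amenable; $G$ is $\mathbb{K}$-amenable of norm $1$; $G$ is locally elliptic and $p$-free. 2. If $\mathbb{K}_0\cong\mathbb{Q}$ with the trivial norm, then the following are equivalent: $G$ is normed $\mathbb{K}$-amenable; $G$ is $\mathbb{K}$-amenable of norm $1$; $G$ is locally elliptic. 3. If $\mathbb{K}_0\cong\mathbb{Q}_p$ as topological fields, then $G$ is normed $\mathbb{K}$-amenable if and only if it is locally elliptic and $p^{\mathbb{N}}$-free. In this case, if the norm of $\mathbb{K}$ is normalized so that $|p|_{\mathbb{K}}=p^{-1}$, then $$\|G\|_{\mathbb{K}}=\min\{p^k : k\ge 0,\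 G \text{ is } p^{k+1}\text{-free}\}.$$ -/

import Mathlib

open BoundedContinuousFunction
open scoped ENNReal

/-- A metric space is spherically complete if every decreasing sequence of closed balls
(of positive radius) has nonempty intersection. -/
def IsSphericallyComplete (X : Type*) [PseudoMetricSpace X] : Prop :=
  ∀ (c : ℕ → X) (r : ℕ → ℝ), (∀ n, 0 < r n) →
    Antitone (fun n => Metric.closedBall (c n) (r n)) →
    (⋂ n, Metric.closedBall (c n) (r n)).Nonempty

/-- The closure of the prime field of a normed field, with the restricted norm. -/
abbrev primeFieldClosure (K : Type*) [NormedField K] : Subfield K :=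
  (⊥ : Subfield K).topologicalClosure

/-- The left translate `g • f : x ↦ f (g⁻¹ x)` of a bounded continuous function. -/
def leftTranslate {G : Type*} [Group G] [TopologicalSpace G] [IsTopologicalGroup G]
    {K : Type*} [NormedField K] (g : G) (f : G →ᵇ K) : G →ᵇ K :=
  f.compContinuous ⟨fun x => g⁻¹ * x, continuous_const_mul g⁻¹⟩

/-- A linear functional on `C_b(G, K)` is a left-invariant normed `K`-mean if it is bounded,
maps the constant function `1` to `1`, and is invariant under left translation. -/
structure IsInvariantNormedMean {G : Type*} [Group G] [TopologicalSpace G]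
    [IsTopologicalGroup G] {K : Type*} [NormedField K] (m : (G →ᵇ K) →ₗ[K] K) : Prop where
  bounded : ∃ C : ℝ, 0 ≤ C ∧ ∀ f, ‖m f‖ ≤ C * ‖f‖
  map_one : m (const G 1) = 1
  invariant : ∀ (g : G) (f : G →ᵇ K), m (leftTranslate g f) = m f

/-- The operator norm of a (bounded) linear functional on `C_b(G, K)`; Mathlib's operator norm
is not available because `K` may be trivially valued. -/
noncomputable def meanNorm {G : Type*} [TopologicalSpace G] {K : Type*} [NormedField K]
    (m : (G →ᵇ K) →ₗ[K] K) : ℝ :=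
  sInf {C : ℝ | 0 ≤ C ∧ ∀ f, ‖m f‖ ≤ C * ‖f‖}

/-- `G` is normed `K`-amenable if it admits a left-invariant normed `K`-mean. -/
def IsNormedAmenable (K : Type*) [NormedField K] (G : Type*) [Group G] [TopologicalSpace G]
    [IsTopologicalGroup G] : Prop :=
  ∃ m : (G →ᵇ K) →ₗ[K] K, IsInvariantNormedMean m

/-- `‖G‖_K`: the infimum of the norms of the left-invariant normed `K`-means on `G`; it is `∞` if
there are none. -/
noncomputable def amenabilityNorm (K : Type*) [NormedField K] (G : Type*) [Group G]
    [TopologicalSpace G] [IsTopologicalGroup G] : ℝ≥0∞ :=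
  ⨅ (m : (G →ᵇ K) →ₗ[K] K) (_ : IsInvariantNormedMean m), ENNReal.ofReal (meanNorm m)

/-- `G` is `K`-amenable of norm `c`. -/
def IsAmenableOfNorm (K : Type*) [NormedField K] (G : Type*) [Group G] [TopologicalSpace G]
    [IsTopologicalGroup G] (c : ℝ≥0∞) : Prop :=
  IsNormedAmenable K G ∧ amenabilityNorm K G = c

/-- `G` is locally elliptic if it is a directed union of compact open subgroups. -/
def IsLocallyElliptic (G : Type*) [Group G] [TopologicalSpace G] : Prop :=
  ∃ S : Set (Subgroup G), DirectedOn (· ≤ ·) S ∧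
    (∀ U ∈ S, IsCompact (U : Set G) ∧ IsOpen (U : Set G)) ∧
    ∀ g : G, ∃ U ∈ S, g ∈ U

/-- `G` is `n`-free if `n` divides no finite index `[U : V]` of open subgroups `V ≤ U ≤ G`.
(In Mathlib, `V.relIndex U` is `[U : V]`, and is `0` exactly when the index is infinite.) -/
def IsIndexFree (n : ℕ) (G : Type*) [Group G] [TopologicalSpace G] : Prop :=
  ∀ V U : Subgroup G, IsOpen (V : Set G) → IsOpen (U : Set G) → V ≤ U →
    V.relIndex U ≠ 0 → ¬ n ∣ V.relIndex U

/-- `G` is `n^ℕ`-free if it is `n ^ k`-free for some `k ≥ 1`. -/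
def IsPowIndexFree (n : ℕ) (G : Type*) [Group G] [TopologicalSpace G] : Prop :=
  ∃ k : ℕ, 1 ≤ k ∧ IsIndexFree (n ^ k) G

/-! ### Compact open subgroups and their cosets. -/

section Topology

open Topology Filter

variable {G : Type*} [Group G] [TopologicalSpace G] [IsTopologicalGroup G]

/-! Everything rests on `exists_isInvariantNormedMean_iff`: a mean bounded by `C` exists iff `G` is
locally elliptic and each finite index `n` of open subgroups satisfies `1 ≤ C * ‖n‖`. Only norms of
natural numbers enter, so `K` and the closure of its prime field give the same answer. That closure
is again spherically complete, because its nonzero norms are powers of a single real number. The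
three cases are then arithmetic of `‖n‖`: it is 0 or 1, always 1, or `‖p‖` to the `p`-adic valuation
of `n`.

The index bound is necessary because `1` is a sum of `n` translates of one 0-1-valued function.
Local ellipticity comes from a flow argument. Let `V` be compact open and suppose that no compact
open subgroup contains `V` and `s`. Then no nonempty finite subset of `G ⧸ V` has a preimage stable
under right multiplication by `s` and `s⁻¹`, so a weighted coboundary on the graph with edges `(gV,
gsV)` is injective on finitely supported functions. Dually, every function on `G ⧸ V` is a weighted
boundary modulo `p` (exactly so over `ℚ` if all nonzero integers have norm 1). A mean kills
boundaries, so `1 = m(1) = p^k m(h_k)` with `m(h_k)` bounded and `‖p‖ < 1`, which is absurd.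

For sufficiency, let `D` be the span of the differences `g • f - f`. Averaging over cosets in
compact open subgroups shows that `d + c ↦ c` has norm at most `C` on `D` plus the constants;
Ingleton's theorem extends it. -/

/-- Van Dantzig's theorem. -/
theorem exists_isCompact_isOpen_subgroup_subset [T2Space G] [LocallyCompactSpace G]
    [TotallyDisconnectedSpace G] {U : Set G} (hU : U ∈ 𝓝 (1 : G)) :
    ∃ V : Subgroup G, IsCompact (V : Set G) ∧ IsOpen (V : Set G) ∧ (V : Set G) ⊆ U := by
  obtain ⟨C, hC, hCU, hCc⟩ := local_compact_nhds hU
  obtain ⟨W, hW, h1W, hWC⟩ :=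
    (loc_compact_Haus_tot_disc_of_zero_dim (H := G)).mem_nhds_iff.1 hC
  have hWc : IsCompact W := hCc.of_isClosed_subset hW.1 hWC
  obtain ⟨T, hT, hWT⟩ := compact_open_separated_mul_right hWc hW.2 subset_rfl
  -- The right stabilizer of the compact open set `W`: it contains a neighbourhood of 1 because `W *
  -- T ⊆ W`, and lies in `W` because `1 ∈ W`.
  let H : Subgroup G :=
    { carrier := {g | ∀ x, x ∈ W ↔ x * g ∈ W}
      mul_mem' := fun {a b} ha hb x => by rw [ha x, hb, mul_assoc]
      one_mem' := fun x => by simp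
      inv_mem' := fun {a} ha x => by rw [ha (x * a⁻¹)]; simp }
  have hHo : IsOpen (H : Set G) := by
    refine H.isOpen_of_mem_nhds (g := 1) ?_
    filter_upwards [hT, inv_mem_nhds_one G hT] with g hg hg' x
    refine ⟨fun hx => hWT (Set.mul_mem_mul hx hg), fun hx => ?_⟩
    simpa using hWT (Set.mul_mem_mul hx hg')
  have hHW : (H : Set G) ⊆ W := fun g hg => by simpa using (hg 1).1 h1W
  exact ⟨H, hWc.of_isClosed_subset (H.isClosed_of_isOpen hHo) hHW, hHo, hHW.trans (hWC.trans hCU)⟩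

theorem Subgroup.isCompact_preimage_mk {V : Subgroup G} (hV : IsCompact (V : Set G))
    {A : Set (G ⧸ V)} (hA : A.Finite) : IsCompact ((QuotientGroup.mk : G → G ⧸ V) ⁻¹' A) := by
  have : (QuotientGroup.mk : G → G ⧸ V) ⁻¹' A =
      ⋃ x ∈ A, (fun v => Quotient.out x * v) '' (V : Set G) := by
    ext g
    simp only [Set.mem_preimage, Set.mem_iUnion, Set.mem_image, exists_prop]
    constructor
    · intro hg
      refine ⟨_, hg, (Quotient.out (g : G ⧸ V))⁻¹ * g, ?_, by group⟩
      exact QuotientGroup.eq.1 (QuotientGroup.out_eq' (g : G ⧸ V))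
    · rintro ⟨x, hx, v, hv, rfl⟩
      rw [QuotientGroup.mk_mul_of_mem _ hv]
      rwa [QuotientGroup.out_eq']
  rw [this]
  exact hA.isCompact_biUnion fun x _ => hV.image (continuous_const_mul _)

theorem finite_image_quotient_mk {V : Subgroup G} (hVo : IsOpen (V : Set G)) {C : Set G}
    (hC : IsCompact C) : ((QuotientGroup.mk : G → G ⧸ V) '' C).Finite := by
  have := QuotientGroup.discreteTopology hVo
  exact (hC.image QuotientGroup.continuous_mk).finite_of_discrete

theorem Subgroup.relIndex_ne_zero_of_isCompact {V U : Subgroup G} (hVo : IsOpen (V : Set G))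
    (hU : IsCompact (U : Set G)) : V.relIndex U ≠ 0 := by
  have : CompactSpace U := isCompact_iff_compactSpace.1 hU
  have : Finite (U ⧸ V.subgroupOf U) :=
    (V.subgroupOf U).quotient_finite_of_isOpen (hVo.preimage continuous_subtype_val)
  exact Nat.card_pos.ne'

end Topology

/-! ### Hahn-Banach over spherically complete fields. -/

section Ingleton

/-- In a spherically complete ultrametric space, pairwise meeting balls (possibly of radius zero)
have a common point. -/
theorem IsSphericallyComplete.nonempty_iInter {X : Type*} [PseudoMetricSpace X] [IsUltrametricDist X]
    (hX : IsSphericallyComplete X) {ι : Type*} [Nonempty ι] (c : ι → X) (r : ι → ℝ)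
    (hr : ∀ i, 0 ≤ r i) (h : ∀ i j, dist (c i) (c j) ≤ max (r i) (r j)) :
    ∃ a, ∀ i, dist (c i) a ≤ r i := by
  -- A smallest ball, if any, has its centre in all the others; this absorbs radius zero. Otherwise
  -- a sequence of positive radii decreasing to the infimum suffices.
  by_cases hmin : ∃ i, ∀ j, r i ≤ r j
  · obtain ⟨i, hi⟩ := hmin
    exact ⟨c i, fun j => (h j i).trans (by simp [hi j])⟩
  push Not at hmin
  have hbdd : BddBelow (Set.range r) := ⟨0, by rintro _ ⟨i, rfl⟩; exact hr i⟩
  have hlt : ∀ i, iInf r < r i := fun i => by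
    obtain ⟨j, hj⟩ := hmin i
    exact (ciInf_le hbdd j).trans_lt hj
  obtain ⟨u, hu, -, hlim, hmem⟩ :=
    (isGLB_ciInf hbdd).exists_seq_strictAnti_tendsto_of_notMem
      (by rintro ⟨i, hi⟩; exact (hlt i).ne' hi) (Set.range_nonempty r)
  choose k hk using hmem
  obtain ⟨a, ha⟩ := hX (fun n => c (k n)) (fun n => r (k n))
    (fun n => ((Real.iInf_nonneg hr).trans_lt (hlt _))) (by
      refine antitone_nat_of_succ_le fun n x hx => ?_
      have h1 : r (k (n + 1)) ≤ r (k n) := by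
        rw [hk, hk]; exact hu.antitone n.le_succ
      rw [Metric.mem_closedBall] at hx ⊢
      refine (dist_triangle_max _ (c (k (n + 1))) _).trans (max_le (hx.trans h1) ?_)
      exact (h _ _).trans (by simp [h1]))
  refine ⟨a, fun i => ?_⟩
  obtain ⟨n, hn⟩ := (hlim.eventually_lt_const (hlt i)).exists
  have h1 : r (k n) ≤ r i := by rw [hk]; exact hn.le
  have h2 : dist a (c (k n)) ≤ r (k n) := Set.mem_iInter.1 ha n
  refine (dist_triangle_max _ (c (k n)) _).trans (max_le ((h _ _).trans (by simp [h1])) ?_)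
  rw [dist_comm]
  exact h2.trans h1

variable {K : Type*} [NormedField K] [IsUltrametricDist K] {E : Type*} [AddCommGroup E] [Module K E]

/-- The one-dimensional step of Ingleton's theorem. -/
theorem LinearPMap.exists_extend_singleton_of_norm_le (hK : IsSphericallyComplete K) (q : E → ℝ)
    (hq : ∀ x, 0 ≤ q x) (hsmul : ∀ (c : K) x, q (c • x) = ‖c‖ * q x)
    (hadd : ∀ x y, q (x + y) ≤ max (q x) (q y)) (f : E →ₗ.[K] K)
    (hf : ∀ x : f.domain, ‖f x‖ ≤ q x) (hdom : f.domain ≠ ⊤) :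
    ∃ g, f < g ∧ ∀ x : g.domain, ‖g x‖ ≤ q x := by
  obtain ⟨y, -, hy⟩ := SetLike.exists_of_lt (lt_top_iff_ne_top.2 hdom)
  have hneg : ∀ x, q (-x) = q x := fun x => by simpa using hsmul (-1) x
  -- A value `a` at `y` is admissible when `‖f v + a‖ ≤ q (y + v)` for all `v`: it must lie in every
  -- ball about `-f v` of radius `q (y + v)`.
  obtain ⟨a, ha⟩ := hK.nonempty_iInter (fun v : f.domain => -f v) (fun v => q (y + v))
    (fun v => hq _) (fun v w => by
      rw [dist_eq_norm, neg_sub_neg, ← LinearPMap.map_sub]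
      refine (hf _).trans ?_
      have : ((w - v : f.domain) : E) = (y + w) + -(y + v) := by
        rw [AddSubgroupClass.coe_sub]; abel
      rw [this]
      refine (hadd _ _).trans ?_
      rw [hneg, max_comm])
  refine ⟨f.supSpanSingleton y a hy, ?_, ?_⟩
  · refine lt_iff_le_not_ge.2 ⟨f.left_le_sup _ _, fun H => ?_⟩
    replace H := LinearPMap.domain_mono.monotone H
    rw [LinearPMap.domain_supSpanSingleton, sup_le_iff, Submodule.span_le,
      Set.singleton_subset_iff] at H
    exact hy H.2
  · rintro ⟨z, hz⟩
    rcases Submodule.mem_sup.1 hz with ⟨x, hx, y', hy', rfl⟩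
    rcases Submodule.mem_span_singleton.1 hy' with ⟨r, rfl⟩
    rw [LinearPMap.supSpanSingleton_apply_mk _ _ _ _ _ hx]
    rcases eq_or_ne r 0 with rfl | hr
    · simpa using hf ⟨x, hx⟩
    · have h1 := ha (r⁻¹ • ⟨x, hx⟩)
      rw [dist_eq_norm, LinearPMap.map_smul] at h1
      have h2 : f ⟨x, hx⟩ + r • a = -(r * (-(r⁻¹ • f ⟨x, hx⟩) - a)) := by
        simp only [smul_eq_mul]; field_simp; ring
      have h3 : x + r • y = r • (y + r⁻¹ • x) := by
        rw [smul_add, smul_smul, mul_inv_cancel₀ hr, one_smul, add_comm]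
      simp only [RingHom.id_apply]
      rw [h2, norm_neg, norm_mul, h3, hsmul]
      exact mul_le_mul_of_nonneg_left h1 (norm_nonneg r)

/-- Ingleton's theorem: the Hahn-Banach theorem over spherically complete fields. -/
theorem LinearPMap.exists_extend_of_norm_le (hK : IsSphericallyComplete K) (q : E → ℝ)
    (hq : ∀ x, 0 ≤ q x) (hsmul : ∀ (c : K) x, q (c • x) = ‖c‖ * q x)
    (hadd : ∀ x y, q (x + y) ≤ max (q x) (q y)) (f : E →ₗ.[K] K)
    (hf : ∀ x : f.domain, ‖f x‖ ≤ q x) :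
    ∃ g : E →ₗ[K] K, (∀ x : f.domain, g x = f x) ∧ ∀ x, ‖g x‖ ≤ q x := by
  set S := {p : E →ₗ.[K] K | ∀ x : p.domain, ‖p x‖ ≤ q x}
  have hSc : ∀ c, c ⊆ S → IsChain (· ≤ ·) c → ∀ y ∈ c, ∃ ub ∈ S, ∀ z ∈ c, z ≤ ub := by
    intro c hcs c_chain y hy
    have cne : c.Nonempty := ⟨y, hy⟩
    have hcd : DirectedOn (· ≤ ·) c := c_chain.directedOn
    refine ⟨LinearPMap.sSup c hcd, ?_, fun _ ↦ LinearPMap.le_sSup hcd⟩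
    rintro ⟨x, hx⟩
    have hdir : DirectedOn (· ≤ ·) (LinearPMap.domain '' c) :=
      directedOn_image.2 (hcd.mono LinearPMap.domain_mono.monotone)
    rcases (Submodule.mem_sSup_of_directed (cne.image _) hdir).1 hx with ⟨_, ⟨p, hpc, rfl⟩, hpx⟩
    have hle : p ≤ LinearPMap.sSup c hcd := LinearPMap.le_sSup _ hpc
    have h1 := hcs hpc ⟨x, hpx⟩
    rwa [hle.2 (y := ⟨x, hx⟩) rfl] at h1
  obtain ⟨p, hfp, hpS, hp⟩ := zorn_le_nonempty₀ S hSc f hf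
  have htop : p.domain = ⊤ := by
    by_contra hne
    obtain ⟨r, hpr, hr⟩ := p.exists_extend_singleton_of_norm_le hK q hq hsmul hadd hpS hne
    exact hpr.not_ge (hp hr hpr.le)
  obtain ⟨dom, p⟩ := p
  obtain rfl : dom = ⊤ := htop
  exact ⟨p.comp (LinearMap.id.codRestrict ⊤ fun _ ↦ trivial), fun x => (hfp.2 rfl).symm,
    fun x => hpS ⟨x, trivial⟩⟩

end Ingleton

/-! ### Solving weighted boundary equations by duality. -/

section Flow

variable {X E : Type*}

/-- A weighted boundary operator with finite fibres is surjective over a field as soon as the dual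
coboundary operator is injective on finitely supported functions. -/
theorem exists_weighted_boundary_eq {F : Type*} [Field F] {o t : E → X}
    (ho : ∀ x, (o ⁻¹' {x}).Finite) (ht : ∀ x, (t ⁻¹' {x}).Finite) (a b : F)
    (hinj : ∀ f : X →₀ F, (∀ e, b * f (o e) = a * f (t e)) → f = 0) (h : X → F) :
    ∃ φ : E → F, ∀ x,
      h x = b * ∑ e ∈ (ho x).toFinset, φ e - a * ∑ e ∈ (ht x).toFinset, φ e := by
  classical
  let d : (X →₀ F) →ₗ[F] (E →₀ F) := Finsupp.linearCombination F fun x =>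
    b • ∑ e ∈ (ho x).toFinset, Finsupp.single e (1 : F) -
      a • ∑ e ∈ (ht x).toFinset, Finsupp.single e (1 : F)
  have hd : ∀ f e, d f e = b * f (o e) - a * f (t e) := by
    intro f e
    induction f using Finsupp.induction_linear with
    | zero => simp
    | add f g hf hg => rw [map_add, Finsupp.add_apply, hf, hg]; simp only [Finsupp.add_apply]; ring
    | single x c =>
      simp only [d, Finsupp.linearCombination_single, Finsupp.smul_apply, Finsupp.sub_apply,
        Finsupp.finsetSum_apply, Finsupp.single_apply, Finset.sum_ite_eq', Set.Finite.mem_toFinset,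
        Set.mem_preimage, Set.mem_singleton_iff, smul_eq_mul, eq_comm (a := x)]
      split_ifs <;> ring
  have hdinj : Function.Injective d := by
    rw [← LinearMap.ker_eq_bot, LinearMap.ker_eq_bot']
    intro f hf
    refine hinj f fun e => ?_
    rw [← sub_eq_zero, ← hd, hf, Finsupp.zero_apply]
  -- Arbitrary functions on `X` are the dual of the finitely supported ones, and over a field the
  -- dual of an injective map is surjective.
  obtain ⟨ψ, hψ⟩ := LinearMap.dualMap_surjective_of_injective hdinj (Finsupp.linearCombination F h)
  refine ⟨fun e => ψ (Finsupp.single e 1), fun x => ?_⟩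
  have := congrArg (fun u => u (Finsupp.single x 1)) hψ
  simpa [d, LinearMap.dualMap_apply] using this.symm

/-- Solve over `F` and lift the solution pointwise to `R`; the error lies in the kernel of `ρ`,
hence is divisible by `π`. -/
theorem exists_weighted_boundary_add_eq {R F : Type*} [CommRing R] [Field F] (ρ : R →+* F)
    (hρ : Function.Surjective ρ) {π : R} (hπ : ∀ r, ρ r = 0 → ∃ r', r = π * r') {o t : E → X}
    (ho : ∀ x, (o ⁻¹' {x}).Finite) (ht : ∀ x, (t ⁻¹' {x}).Finite) (a b : ℕ)
    (hinj : ∀ f : X →₀ F, (∀ e, (b : F) * f (o e) = a * f (t e)) → f = 0) (h : X → R) :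
    ∃ (φ : E → R) (h' : X → R), ∀ x,
      h x = b * ∑ e ∈ (ho x).toFinset, φ e - a * ∑ e ∈ (ht x).toFinset, φ e + π * h' x := by
  obtain ⟨φ, hφ⟩ := exists_weighted_boundary_eq ho ht (a : F) b hinj (fun x => ρ (h x))
  choose l hl using hρ
  choose h' hh' using fun x => hπ (h x - (b * ∑ e ∈ (ho x).toFinset, l (φ e) -
    a * ∑ e ∈ (ht x).toFinset, l (φ e))) (by simp [hφ, hl])
  exact ⟨fun e => l (φ e), h', fun x => by rw [← hh']; ring⟩

end Flow

/-! ### Invariant means kill weighted boundaries. -/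

section OrbitFunctions

variable {G : Type*} [Group G]

theorem sum_fiber_smul {X E M : Type*} [MulAction G X] [MulAction G E] [AddCommMonoid M] {o : E → X}
    (hoG : ∀ (g : G) e, o (g • e) = g • o e) (ho : ∀ x, (o ⁻¹' {x}).Finite) (φ : E → M) (g : G)
    (x : X) : ∑ e ∈ (ho (g • x)).toFinset, φ e = ∑ e ∈ (ho x).toFinset, φ (g • e) := by
  refine (Finset.sum_equiv (MulAction.toPerm g) (fun e => ?_) (fun e _ => rfl)).symm
  simp [hoG]

variable [TopologicalSpace G] [IsTopologicalGroup G] {K : Type*} [NormedField K]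

/-- The function `g ↦ φ (g⁻¹ • x)` on `G`, for a bounded function `φ` on a `G`-set and a point `x`
with open stabilizer. -/
noncomputable def orbitFunction {X : Type*} [MulAction G X] (x : X)
    (hx : IsOpen (MulAction.stabilizer G x : Set G)) (φ : X → K) (hφ : ∀ y, ‖φ y‖ ≤ 1) : G →ᵇ K :=
  BoundedContinuousFunction.ofNormedAddCommGroup (fun g => φ (g⁻¹ • x))
    (by
      refine IsLocallyConstant.continuous ((IsLocallyConstant.iff_exists_open _).2 fun g =>
        ⟨(fun u => u * g⁻¹) ⁻¹' (MulAction.stabilizer G x : Set G),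
          hx.preimage (continuous_mul_const _), by simp, fun u hu => ?_⟩)
      have hu : (u * g⁻¹) • x = x := hu
      rw [mul_smul, smul_eq_iff_eq_inv_smul] at hu
      simp only [hu])
    1 (fun g => hφ _)

@[simp]
theorem orbitFunction_apply {X : Type*} [MulAction G X] (x : X)
    (hx : IsOpen (MulAction.stabilizer G x : Set G)) (φ : X → K) (hφ : ∀ y, ‖φ y‖ ≤ 1) (g : G) :
    orbitFunction x hx φ hφ g = φ (g⁻¹ • x) := rfl

@[simp]
theorem leftTranslate_apply (g x : G) (f : G →ᵇ K) : leftTranslate g f x = f (g⁻¹ * x) := rfl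

/-- By transitivity on edges, each edge term is a translate of the function at `e₀`, so all have the
same mean. The weights satisfy `hab` precisely so that outgoing and incoming terms cancel. -/
theorem IsInvariantNormedMean.apply_boundary {m : (G →ᵇ K) →ₗ[K] K} (hm : IsInvariantNormedMean m)
    {X E : Type*} [MulAction G X] [MulAction G E] [MulAction.IsPretransitive G E] {o t : E → X}
    (hoG : ∀ (g : G) e, o (g • e) = g • o e) (htG : ∀ (g : G) e, t (g • e) = g • t e)
    (ho : ∀ x, (o ⁻¹' {x}).Finite) (ht : ∀ x, (t ⁻¹' {x}).Finite) (x : X) (e₀ : E)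
    (hx : IsOpen (MulAction.stabilizer G x : Set G))
    (he : IsOpen (MulAction.stabilizer G e₀ : Set G)) {a b : ℕ}
    (hab : b * (ho x).toFinset.card = a * (ht x).toFinset.card) {h h' : X → K} {φ : E → K} {π : K}
    (hh : ∀ x, ‖h x‖ ≤ 1) (hh' : ∀ x, ‖h' x‖ ≤ 1) (hφ : ∀ e, ‖φ e‖ ≤ 1)
    (hsum : ∀ x, h x = b * ∑ e ∈ (ho x).toFinset, φ e - a * ∑ e ∈ (ht x).toFinset, φ e + π * h' x) :
    m (orbitFunction x hx h hh) = π * m (orbitFunction x hx h' hh') := by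
  choose c hc using fun e => MulAction.exists_smul_eq G e₀ e
  have key : orbitFunction x hx h hh =
      (b : K) • ∑ e ∈ (ho x).toFinset, leftTranslate (c e) (orbitFunction e₀ he φ hφ) -
      (a : K) • ∑ e ∈ (ht x).toFinset, leftTranslate (c e) (orbitFunction e₀ he φ hφ) +
      π • orbitFunction x hx h' hh' := by
    ext g
    simp [hsum, sum_fiber_smul hoG, sum_fiber_smul htG, BoundedContinuousFunction.sum_apply,
      mul_smul, hc]
  rw [key]
  simp only [map_add, map_sub, map_smul, map_sum, hm.invariant, Finset.sum_const, smul_eq_mul,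
    nsmul_eq_mul, ← mul_assoc]
  rw [← Nat.cast_mul, ← Nat.cast_mul, hab, sub_self, zero_add]

end OrbitFunctions

theorem norm_natCast_eq_one_of_forall_prime {K : Type*} [NormedField K] [IsUltrametricDist K]
    (h : ∀ p : ℕ, p.Prime → 1 ≤ ‖(p : K)‖)
    {n : ℕ}
    (hn : n ≠ 0) : ‖(n : K)‖ = 1 := by
  refine le_antisymm (IsUltrametricDist.norm_natCast_le_one K n) ?_
  induction n using Nat.recOnMul with
  | zero => exact absurd rfl hn
  | one => simp
  | prime p hp => exact h p hp
  | mul a b ha hb =>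
    rw [Nat.cast_mul, norm_mul]
    exact one_le_mul_of_one_le_of_one_le (ha (left_ne_zero_of_mul hn))
      (hb (right_ne_zero_of_mul hn))

/-! ### A mean forces local ellipticity. -/

section LocallyElliptic

variable {G : Type*} [Group G] [TopologicalSpace G] [IsTopologicalGroup G]

theorem isOpen_stabilizer_quotient {V : Subgroup G} (hVo : IsOpen (V : Set G)) (x : G ⧸ V) :
    IsOpen (MulAction.stabilizer G x : Set G) := by
  have := QuotientGroup.discreteTopology hVo
  obtain ⟨k, rfl⟩ := QuotientGroup.mk_surjective x
  exact (isOpen_discrete {(k : G ⧸ V)}).preimage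
    (QuotientGroup.continuous_mk.comp (continuous_mul_const k))

/-- The right stabilizer of the preimage of `A` works: a translate of it lies in that preimage, a
finite union of cosets of the compact `V`. -/
theorem exists_isCompact_isOpen_insert_of_finite {V : Subgroup G} (hVc : IsCompact (V : Set G))
    (hVo : IsOpen (V : Set G)) (s : G) {A : Set (G ⧸ V)} (hA : A.Finite) (hne : A.Nonempty)
    (hAs : ∀ g : G, (g : G ⧸ V) ∈ A ↔ ((g * s : G) : G ⧸ V) ∈ A) :
    ∃ U : Subgroup G, IsCompact (U : Set G) ∧ IsOpen (U : Set G) ∧ V ≤ U ∧ s ∈ U := by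
  let H : Subgroup G :=
    { carrier := {h | ∀ g : G, (g : G ⧸ V) ∈ A ↔ ((g * h : G) : G ⧸ V) ∈ A}
      mul_mem' := fun {a b} ha hb g => by rw [ha g, hb, mul_assoc]
      one_mem' := fun g => by simp
      inv_mem' := fun {a} ha g => by rw [ha (g * a⁻¹)]; simp }
  have hVH : V ≤ H := fun v hv g => by rw [QuotientGroup.mk_mul_of_mem _ hv]
  have hHo : IsOpen (H : Set G) := Subgroup.isOpen_mono hVH hVo
  obtain ⟨x, hx⟩ := hne
  obtain ⟨g, rfl⟩ := QuotientGroup.mk_surjective x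
  refine ⟨H, ?_, hHo, hVH, hAs⟩
  refine (((V.isCompact_preimage_mk hVc hA)).image
    (continuous_const_mul g⁻¹)).of_isClosed_subset (H.isClosed_of_isOpen hHo) fun h hh => ?_
  exact ⟨g * h, (hh g).1 hx, by simp⟩

/-- If both weights are nonzero, the support of `f` is the required finite set; if just one
vanishes, the equation forces `f = 0`. -/
theorem exists_isCompact_isOpen_insert_of_field {V : Subgroup G} (hVc : IsCompact (V : Set G))
    (hVo : IsOpen (V : Set G)) (s : G) {F : Type*} [Field F] {a b : F} (hab : a ≠ 0 ∨ b ≠ 0)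
    {f : G ⧸ V →₀ F} (hf : f ≠ 0) (h : ∀ g : G, b * f g = a * f (g * s : G)) :
    ∃ U : Subgroup G, IsCompact (U : Set G) ∧ IsOpen (U : Set G) ∧ V ≤ U ∧ s ∈ U := by
  by_cases ha : a = 0
  · refine absurd (Finsupp.ext fun x => ?_) hf
    obtain ⟨g, rfl⟩ := QuotientGroup.mk_surjective x
    simpa [ha, hab.resolve_left (not_not.2 ha)] using h g
  by_cases hb : b = 0
  · refine absurd (Finsupp.ext fun x => ?_) hf
    obtain ⟨g, rfl⟩ := QuotientGroup.mk_surjective x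
    simpa [hb, ha] using h (g * s⁻¹)
  refine exists_isCompact_isOpen_insert_of_finite hVc hVo s f.hasFiniteSupport
    (by simpa using hf) fun g => ?_
  simp only [Finsupp.fun_support_eq, Finset.mem_coe, Finsupp.mem_support_iff, ne_eq]
  refine not_congr ⟨fun h0 => ?_, fun h0 => ?_⟩
  · simpa [h0, ha] using h g
  · simpa [h0, hb] using h g

variable {K : Type*} [NormedField K]

theorem IsInvariantNormedMean.exists_isCompact_isOpen_insert_of_ringHom {m : (G →ᵇ K) →ₗ[K] K}
    (hm : IsInvariantNormedMean m) {V : Subgroup G} (hVc : IsCompact (V : Set G))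
    (hVo : IsOpen (V : Set G)) (s : G) {R F : Type*} [CommRing R] [Field F] (ι : R →+* K)
    (ρ : R →+* F) (hρ : Function.Surjective ρ) {π : R} (hπ : ∀ r, ρ r = 0 → ∃ r', r = π * r')
    (hι : ∀ r, ‖ι r‖ ≤ 1) (hιπ : ‖ι π‖ < 1) :
    ∃ U : Subgroup G, IsCompact (U : Set G) ∧ IsOpen (U : Set G) ∧ V ≤ U ∧ s ∈ U := by
  by_contra hcon
  let x₀ : G ⧸ V := (1 : G)
  -- The edges are the pairs `(gV, gsV)`; compactness of `V` makes in- and out-degrees finite.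
  let E := MulAction.orbit G (x₀, s • x₀)
  let e₀ : E := ⟨(x₀, s • x₀), MulAction.mem_orbit_self _⟩
  let o : E → G ⧸ V := fun e => e.1.1
  let t : E → G ⧸ V := fun e => e.1.2
  have hmk : ∀ g k : G, g • (k : G ⧸ V) = (g * k : G) := fun g k => rfl
  have hE : ∀ e : E, ∃ g : G, e = g • e₀ := by
    rintro ⟨_, g, rfl⟩
    exact ⟨g, rfl⟩
  have hoG : ∀ (g : G) e, o (g • e) = g • o e := fun g e => rfl
  have htG : ∀ (g : G) e, t (g • e) = g • t e := fun g e => rfl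
  have hoe : ∀ g : G, o (g • e₀) = g := fun g => by
    change g • ((1 : G) : G ⧸ V) = g
    rw [hmk, mul_one]
  have hte : ∀ g : G, t (g • e₀) = (g * s : G) := fun g => by
    change g • s • ((1 : G) : G ⧸ V) = _
    rw [hmk, hmk, mul_one]
  have ho : ∀ x, (o ⁻¹' {x}).Finite := fun x => by
    obtain ⟨g, rfl⟩ := QuotientGroup.mk_surjective x
    refine Set.Finite.of_finite_image (f := t) ?_ ?_
    · refine (finite_image_quotient_mk hVo
        ((hVc.image (continuous_const_mul g)).image (continuous_mul_const s))).subset ?_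
      rintro _ ⟨e, he, rfl⟩
      obtain ⟨k, rfl⟩ := hE e
      have he : o (k • e₀) = g := he
      rw [hoe, eq_comm, QuotientGroup.eq] at he
      exact ⟨k * s, ⟨k, ⟨_, he, by simp⟩, rfl⟩, (hte k).symm⟩
    · intro e he e' he' h
      exact Subtype.ext (Prod.ext (he.trans he'.symm) h)
  have ht : ∀ x, (t ⁻¹' {x}).Finite := fun x => by
    obtain ⟨g, rfl⟩ := QuotientGroup.mk_surjective x
    refine Set.Finite.of_finite_image (f := o) ?_ ?_
    · refine (finite_image_quotient_mk hVo
        ((hVc.image (continuous_const_mul g)).image (continuous_mul_const s⁻¹))).subset ?_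
      rintro _ ⟨e, he, rfl⟩
      obtain ⟨k, rfl⟩ := hE e
      have he : t (k • e₀) = g := he
      rw [hte, eq_comm, QuotientGroup.eq] at he
      exact ⟨k, ⟨k * s, ⟨_, he, by simp⟩, by simp⟩, (hoe k).symm⟩
    · intro e he e' he' h
      exact Subtype.ext (Prod.ext h (he.trans he'.symm))
  have hx := isOpen_stabilizer_quotient hVo x₀
  have he : IsOpen (MulAction.stabilizer G e₀ : Set G) := by
    refine Subgroup.isOpen_mono (H₁ := MulAction.stabilizer G x₀ ⊓ MulAction.stabilizer G (s • x₀))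
      (fun g hg => Subtype.ext (Prod.ext hg.1 hg.2)) (hx.inter (isOpen_stabilizer_quotient hVo _))
  set N := (ho x₀).toFinset.card
  set N' := (ht x₀).toFinset.card
  have hNpos : 0 < N := Finset.card_pos.2 ⟨e₀, by simp [o, e₀]⟩
  -- The degrees `N` and `N'` may differ when `G` is not unimodular. Dividing by the gcd makes the
  -- weights coprime, so they cannot both vanish in `F`, whatever its characteristic.
  set a := N / N.gcd N' with ha
  set b := N' / N.gcd N' with hb
  have hab : b * N = a * N' := by
    rw [ha, hb, Nat.div_mul_right_comm (Nat.gcd_dvd_right _ _),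
      Nat.div_mul_right_comm (Nat.gcd_dvd_left _ _), mul_comm]
  have hab0 : (a : F) ≠ 0 ∨ (b : F) ≠ 0 := by
    by_contra! h0
    have hcop : Nat.Coprime a b := Nat.coprime_div_gcd_div_gcd (Nat.gcd_pos_of_pos_left _ hNpos)
    have h1 := congrArg (Int.cast : ℤ → F) (Nat.gcd_eq_gcd_ab a b)
    rw [hcop.gcd_eq_one] at h1
    simp [h0.1, h0.2] at h1
  have hinj : ∀ f : G ⧸ V →₀ F, (∀ e, (b : F) * f (o e) = a * f (t e)) → f = 0 := by
    intro f hf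
    by_contra hf0
    refine hcon (exists_isCompact_isOpen_insert_of_field hVc hVo s hab0 hf0 fun g => ?_)
    simpa only [hoe, hte] using hf (g • e₀)
  have hstep : ∀ h : G ⧸ V → R, ∃ h' : G ⧸ V → R,
      m (orbitFunction x₀ hx (fun x => ι (h x)) fun x => hι _) =
        ι π * m (orbitFunction x₀ hx (fun x => ι (h' x)) fun x => hι _) := by
    intro h
    obtain ⟨φ, h', hh⟩ := exists_weighted_boundary_add_eq ρ hρ hπ ho ht a b hinj h
    refine ⟨h', hm.apply_boundary hoG htG ho ht x₀ e₀ hx he hab _ _ (φ := fun e => ι (φ e))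
      (fun e => hι _) fun x => ?_⟩
    simpa using congrArg ι (hh x)
  have hpow : ∀ (k : ℕ) (h : G ⧸ V → R), ∃ h' : G ⧸ V → R,
      m (orbitFunction x₀ hx (fun x => ι (h x)) fun x => hι _) =
        ι π ^ k * m (orbitFunction x₀ hx (fun x => ι (h' x)) fun x => hι _) := by
    intro k
    induction k with
    | zero => exact fun h => ⟨h, by simp⟩
    | succ k ih =>
      intro h
      obtain ⟨h₁, e₁⟩ := hstep h
      obtain ⟨h₂, e₂⟩ := ih h₁
      exact ⟨h₂, by rw [e₁, e₂, pow_succ']; ring⟩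
  obtain ⟨C, hC0, hC⟩ := hm.bounded
  have hle : ∀ k : ℕ, 1 ≤ ‖ι π‖ ^ k * C := by
    intro k
    obtain ⟨h', hh'⟩ := hpow k 1
    have h1 : orbitFunction x₀ hx (fun x => ι ((1 : G ⧸ V → R) x)) (fun x => hι _) = const G 1 := by
      ext g; simp
    rw [h1, hm.map_one] at hh'
    calc (1 : ℝ) = ‖(1 : K)‖ := norm_one.symm
      _ ≤ ‖ι π‖ ^ k * C := by
        rw [hh', norm_mul, norm_pow]
        refine mul_le_mul_of_nonneg_left ((hC _).trans (mul_le_of_le_one_right hC0 ?_))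
          (by positivity)
        exact (norm_le zero_le_one).2 fun g => hι _
  -- The lower bound 1 contradicts `‖ι π‖ ^ k * C → 0`.
  have hlim := (tendsto_pow_atTop_nhds_zero_of_lt_one (norm_nonneg _) hιπ).mul_const C
  rw [zero_mul] at hlim
  exact absurd (ge_of_tendsto' hlim hle) (by norm_num)

variable [IsUltrametricDist K]

theorem IsInvariantNormedMean.exists_isCompact_isOpen_insert {m : (G →ᵇ K) →ₗ[K] K}
    (hm : IsInvariantNormedMean m) {V : Subgroup G} (hVc : IsCompact (V : Set G))
    (hVo : IsOpen (V : Set G)) (s : G) :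
    ∃ U : Subgroup G, IsCompact (U : Set G) ∧ IsOpen (U : Set G) ∧ V ≤ U ∧ s ∈ U := by
  by_cases h : ∃ p : ℕ, p.Prime ∧ ‖(p : K)‖ < 1
  · obtain ⟨p, hp, hpK⟩ := h
    have := Fact.mk hp
    refine hm.exists_isCompact_isOpen_insert_of_ringHom hVc hVo s (Int.castRingHom K)
      (Int.castRingHom (ZMod p)) (ZMod.ringHom_surjective _) (π := (p : ℤ)) (fun r hr => ?_)
      (fun r => IsUltrametricDist.norm_intCast_le_one K r) (by simpa using hpK)
    exact (ZMod.intCast_zmod_eq_zero_iff_dvd r p).1 hr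
  · push Not at h
    have hnat : ∀ n : ℕ, n ≠ 0 → ‖(n : K)‖ = 1 := fun n => norm_natCast_eq_one_of_forall_prime h
    have : CharZero K := charZero_of_inj_zero fun n hn => by
      by_contra h0
      simpa [hn] using hnat n h0
    -- All of `ℚ` has norm at most 1 here, so no reduction is needed: `R = F = ℚ` and `π = 0`.
    refine hm.exists_isCompact_isOpen_insert_of_ringHom hVc hVo s (algebraMap ℚ K)
      (RingHom.id ℚ) Function.surjective_id (π := 0) (fun r hr => ⟨0, by simpa using hr⟩)
      (fun r => ?_) (by simp)
    rw [eq_ratCast, Rat.cast_def, norm_div, hnat _ r.den_ne_zero, div_one]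
    exact IsUltrametricDist.norm_intCast_le_one K _

theorem IsInvariantNormedMean.isLocallyElliptic [T2Space G] [LocallyCompactSpace G]
    [TotallyDisconnectedSpace G] {m : (G →ᵇ K) →ₗ[K] K} (hm : IsInvariantNormedMean m) :
    IsLocallyElliptic G := by
  have hfin : ∀ T : Set G, T.Finite → ∀ V : Subgroup G, IsCompact (V : Set G) →
      IsOpen (V : Set G) → ∃ U : Subgroup G, IsCompact (U : Set G) ∧ IsOpen (U : Set G) ∧ V ≤ U ∧
        T ⊆ U := by
    intro T hT V hVc hVo
    induction T, hT using Set.Finite.induction_on with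
    | empty => exact ⟨V, hVc, hVo, le_rfl, by simp⟩
    | insert _ _ ih =>
      obtain ⟨U, hUc, hUo, hVU, hTU⟩ := ih
      obtain ⟨U', hUc', hUo', hUU', hs⟩ := hm.exists_isCompact_isOpen_insert hUc hUo _
      exact ⟨U', hUc', hUo', hVU.trans hUU', Set.insert_subset hs (hTU.trans hUU')⟩
  refine ⟨{U | IsCompact (U : Set G) ∧ IsOpen (U : Set G)}, ?_, fun U hU => hU, fun g => ?_⟩
  · rintro U₁ ⟨hc₁, ho₁⟩ U₂ ⟨hc₂, ho₂⟩
    -- Finitely many cosets of `U₁` cover `U₂`, so adjoining their representatives to `U₁` captures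
    -- `U₂`.
    obtain ⟨U, hUc, hUo, hU, hT⟩ := hfin _
      ((finite_image_quotient_mk ho₁ hc₂).image Quotient.out) U₁ hc₁ ho₁
    refine ⟨U, ⟨hUc, hUo⟩, hU, fun g hg => ?_⟩
    have h1 : Quotient.out (g : G ⧸ U₁) ∈ U := hT ⟨_, ⟨g, hg, rfl⟩, rfl⟩
    have h2 : (Quotient.out (g : G ⧸ U₁))⁻¹ * g ∈ U₁ :=
      QuotientGroup.eq.1 (QuotientGroup.out_eq' (g : G ⧸ U₁))
    simpa using U.mul_mem h1 (hU h2)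
  · obtain ⟨V, hVc, hVo, -⟩ := exists_isCompact_isOpen_subgroup_subset (G := G) Filter.univ_mem
    obtain ⟨U, hUc, hUo, -, hg⟩ := hm.exists_isCompact_isOpen_insert hVc hVo g
    exact ⟨U, ⟨hUc, hUo⟩, hg⟩

end LocallyElliptic

/-! ### Finite indices bound the norm of a mean from below. -/

section IndexBound

variable {G : Type*} [Group G] [TopologicalSpace G] [IsTopologicalGroup G] {K : Type*}
  [NormedField K]

theorem IsInvariantNormedMean.one_le_mul_norm_relIndex {m : (G →ᵇ K) →ₗ[K] K}
    (hm : IsInvariantNormedMean m) {C : ℝ} (hC0 : 0 ≤ C) (hC : ∀ f, ‖m f‖ ≤ C * ‖f‖)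
    {V U : Subgroup G} (hVo : IsOpen (V : Set G)) (hVU : V ≤ U) (h0 : V.relIndex U ≠ 0) :
    1 ≤ C * ‖(V.relIndex U : K)‖ := by
  classical
  have : (V.subgroupOf U).FiniteIndex := ⟨h0⟩
  have := Fintype.ofFinite (U ⧸ V.subgroupOf U)
  -- `r` picks representatives of the right cosets `U g`. Below, `f` is the indicator of `V` times
  -- these representatives; its translates by `U ⧸ V` partition `G`.
  let r : G → G := fun g => (Quotient.mk (QuotientGroup.rightRel U) g).out
  have hrU : ∀ g, g * (r g)⁻¹ ∈ U := fun g =>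
    QuotientGroup.rightRel_apply.1 (Quotient.exact (Quotient.out_eq _))
  have hr : ∀ u ∈ U, ∀ g, r (u * g) = r g := fun u hu g => congrArg Quotient.out
    (Quotient.sound (QuotientGroup.rightRel_apply.2 (by simpa using U.inv_mem hu)))
  let f : G →ᵇ K := BoundedContinuousFunction.ofNormedAddCommGroup
    (fun g => if g * (r g)⁻¹ ∈ V then 1 else 0)
    (by
      refine IsLocallyConstant.continuous ((IsLocallyConstant.iff_exists_open _).2 fun g =>
        ⟨(fun u => u * g⁻¹) ⁻¹' (V : Set G), hVo.preimage (continuous_mul_const _), by simp,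
          fun u hu => ?_⟩)
      have hu : u * g⁻¹ ∈ V := hu
      have h1 : r u = r g := by simpa using hr _ (hVU hu) g
      have h2 : u * (r u)⁻¹ = u * g⁻¹ * (g * (r g)⁻¹) := by rw [h1]; group
      simp only [h2, V.mul_mem_cancel_left hu])
    1 (fun g => by split_ifs <;> simp)
  have hsum : ∑ q : U ⧸ V.subgroupOf U, leftTranslate (q.out : G) f = const G 1 := by
    ext g
    let u : U := ⟨g * (r g)⁻¹, hrU g⟩
    have hq : ∀ q : U ⧸ V.subgroupOf U, leftTranslate (q.out : G) f g =
        if q = (u : U ⧸ V.subgroupOf U) then 1 else 0 := by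
      intro q
      have h1 : r ((q.out : G)⁻¹ * g) = r g := hr _ (U.inv_mem q.out.2) g
      change (if (q.out : G)⁻¹ * g * (r ((q.out : G)⁻¹ * g))⁻¹ ∈ V then (1 : K) else 0) = _
      refine if_congr ?_ rfl rfl
      conv_rhs => rw [← QuotientGroup.out_eq' q, QuotientGroup.eq, Subgroup.mem_subgroupOf]
      rw [h1, mul_assoc]
      rfl
    simp [BoundedContinuousFunction.sum_apply, hq]
  have h1 := congrArg m hsum
  simp only [map_sum, hm.invariant, hm.map_one, Finset.sum_const, Finset.card_univ,
    nsmul_eq_mul] at h1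
  have hcard : Fintype.card (U ⧸ V.subgroupOf U) = V.relIndex U := Nat.card_eq_fintype_card.symm
  rw [hcard] at h1
  have hf : ‖m f‖ ≤ C := (hC f).trans (mul_le_of_le_one_right hC0
    ((norm_le zero_le_one).2 fun g => by
      change ‖(if _ then (1 : K) else 0)‖ ≤ 1
      split_ifs <;> simp))
  calc (1 : ℝ) = ‖(1 : K)‖ := norm_one.symm
    _ ≤ C * ‖(V.relIndex U : K)‖ := by
      rw [← h1, norm_mul, mul_comm]
      exact mul_le_mul_of_nonneg_right hf (norm_nonneg _)

end IndexBound

/-! ### Averages over finite coset spaces. -/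

section CosetAverage

open Topology Filter

variable {G : Type*} [Group G] {K : Type*} [NormedField K]

/-- The average of the values of `f` over a set of representatives of `U ⧸ W`. -/
noncomputable def cosetAverage (U W : Subgroup G) (f : G → K) : K :=
  (W.relIndex U : K)⁻¹ * ∑ᶠ q : U ⧸ W.subgroupOf U, f (q.out : U)

theorem finite_quotient_of_relIndex_ne_zero {U W : Subgroup G} (h : W.relIndex U ≠ 0) :
    Finite (U ⧸ W.subgroupOf U) := by
  have : (W.subgroupOf U).FiniteIndex := ⟨h⟩
  infer_instance

theorem cosetAverage_add {U W : Subgroup G} (h : W.relIndex U ≠ 0) (f f' : G → K) :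
    cosetAverage U W (fun g => f g + f' g) = cosetAverage U W f + cosetAverage U W f' := by
  have := finite_quotient_of_relIndex_ne_zero h
  rw [cosetAverage, finsum_add_distrib (Set.toFinite _) (Set.toFinite _), mul_add]
  rfl

theorem cosetAverage_mul (U W : Subgroup G) (c : K) (f : G → K) :
    cosetAverage U W (fun g => c * f g) = c * cosetAverage U W f := by
  rw [cosetAverage, ← mul_finsum, mul_left_comm]
  rfl

theorem cosetAverage_const {U W : Subgroup G} (h : (W.relIndex U : K) ≠ 0) (c : K) :
    cosetAverage U W (fun _ => c) = c := by
  have := finite_quotient_of_relIndex_ne_zero (U := U) (W := W) (by rintro h0; simp [h0] at h)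
  have := Fintype.ofFinite (U ⧸ W.subgroupOf U)
  have hcard : Fintype.card (U ⧸ W.subgroupOf U) = W.relIndex U := Nat.card_eq_fintype_card.symm
  rw [cosetAverage, finsum_eq_sum_of_fintype, Finset.sum_const, Finset.card_univ, hcard,
    nsmul_eq_mul, inv_mul_cancel_left₀ h]

variable [IsUltrametricDist K]

theorem norm_inv_mul_finsum_le {U W : Subgroup G} {C : ℝ} (h : 1 ≤ C * ‖(W.relIndex U : K)‖)
    {f : U ⧸ W.subgroupOf U → K} {ε : ℝ} (hε : 0 ≤ ε) (hf : ∀ q, ‖f q‖ ≤ ε) :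
    ‖(W.relIndex U : K)⁻¹ * ∑ᶠ q, f q‖ ≤ C * ε := by
  have hpos : 0 < ‖(W.relIndex U : K)‖ := by
    refine (norm_nonneg _).lt_of_ne fun h0 => ?_
    rw [← h0, mul_zero] at h
    exact absurd h (by norm_num)
  have := finite_quotient_of_relIndex_ne_zero (U := U) (W := W)
    (by rintro h0; simp [h0] at hpos)
  have := Fintype.ofFinite (U ⧸ W.subgroupOf U)
  rw [finsum_eq_sum_of_fintype, norm_mul, norm_inv]
  refine mul_le_mul ?_ (IsUltrametricDist.norm_sum_le_of_forall_le_of_nonneg hε fun q _ => hf q)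
    (norm_nonneg _) (le_of_mul_le_mul_right ((zero_mul _).trans_le (zero_le_one.trans h)) hpos)
  rwa [inv_le_iff_one_le_mul₀ hpos]

/-- Translation permutes the cosets and changes representatives only by elements of `W`. After
reindexing, each term is at most `ε`; the ultrametric sum keeps this bound and dividing by the index
costs `C`. -/
theorem norm_cosetAverage_translate_sub_le {U W : Subgroup G} {C : ℝ}
    (h : 1 ≤ C * ‖(W.relIndex U : K)‖) {f : G → K} {ε : ℝ} (hε : 0 ≤ ε)
    (hf : ∀ x ∈ U, ∀ w ∈ W, ‖f (x * w) - f x‖ ≤ ε) {g : G} (hg : g ∈ U) :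
    ‖cosetAverage U W (fun x => f (g⁻¹ * x) - f x)‖ ≤ C * ε := by
  have h0 : W.relIndex U ≠ 0 := by
    rintro h0
    rw [h0, Nat.cast_zero, norm_zero, mul_zero] at h
    exact absurd h (by norm_num)
  have := finite_quotient_of_relIndex_ne_zero h0
  let γ : U := ⟨g⁻¹, U.inv_mem hg⟩
  have hperm : ∑ᶠ q : U ⧸ W.subgroupOf U, f ((γ • q).out : U) =
      ∑ᶠ q : U ⧸ W.subgroupOf U, f (q.out : U) :=
    finsum_comp_equiv (MulAction.toPerm γ) (f := fun q : U ⧸ W.subgroupOf U => f (q.out : U))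
  rw [cosetAverage, finsum_sub_distrib (Set.toFinite _) (Set.toFinite _), ← hperm,
    ← finsum_sub_distrib (Set.toFinite _) (Set.toFinite _)]
  refine norm_inv_mul_finsum_le h hε fun q => ?_
  have hmem : ((γ • q).out : U)⁻¹ * (γ * q.out) ∈ W.subgroupOf U := by
    refine QuotientGroup.eq.1 ((QuotientGroup.out_eq' _).trans ?_)
    exact congrArg (γ • ·) (QuotientGroup.out_eq' q).symm
  have := hf _ ((γ • q).out).2 _ (Subgroup.mem_subgroupOf.1 hmem)
  have heq : (((γ • q).out : U) : G) * ((((γ • q).out : U)⁻¹ * (γ * q.out) : U) : G) =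
      g⁻¹ * (q.out : U) := by
    rw [← Subgroup.coe_mul, mul_inv_cancel_left]
    rfl
  rwa [heq] at this

end CosetAverage

/-- The operator norm is itself an admissible bound, so norms of means may be replaced by arbitrary
bounds. -/
theorem amenabilityNorm_eq_iInf {G : Type*} [Group G] [TopologicalSpace G] [IsTopologicalGroup G]
    {K : Type*} [NormedField K] :
    amenabilityNorm K G = ⨅ (C : ℝ) (_ : ∃ m : (G →ᵇ K) →ₗ[K] K, IsInvariantNormedMean m ∧
      ∀ f, ‖m f‖ ≤ C * ‖f‖), ENNReal.ofReal C := by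
  refine le_antisymm (le_iInf₂ fun C ⟨m, hm, hC⟩ => ?_) (le_iInf₂ fun m hm => ?_)
  · refine iInf₂_le_of_le m hm (ENNReal.ofReal_le_ofReal (csInf_le ⟨0, fun c hc => hc.1⟩ ⟨?_, hC⟩))
    have := (norm_nonneg _).trans (hC (const G 1))
    rwa [norm_const_eq, norm_one, mul_one] at this
  · refine iInf₂_le (meanNorm m) ⟨m, hm, fun f => ?_⟩
    rcases eq_or_ne f 0 with rfl | hf
    · simp
    rw [← div_le_iff₀ (norm_pos_iff.2 hf)]
    exact le_csInf hm.bounded fun c hc => (div_le_iff₀ (norm_pos_iff.2 hf)).2 (hc.2 f)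

/-! ### Construction of means and the amenability criterion. -/

section Existence

open Topology Filter

variable {G : Type*} [Group G] [TopologicalSpace G] [IsTopologicalGroup G] [T2Space G]
  [LocallyCompactSpace G] [TotallyDisconnectedSpace G] {K : Type*} [NormedField K]

theorem exists_isOpen_subgroup_norm_mul_sub_le {U : Subgroup G} (hU : IsCompact (U : Set G))
    {f : G → K} (hf : Continuous f) {ε : ℝ} (hε : 0 < ε) :
    ∃ V : Subgroup G, IsOpen (V : Set G) ∧ ∀ x ∈ U, ∀ w ∈ V, ‖f (x * w) - f x‖ ≤ ε := by
  have ho : IsOpen {p : G × G | ‖f (p.1 * p.2) - f p.1‖ < ε} :=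
    isOpen_lt (by fun_prop) continuous_const
  obtain ⟨u, v, -, hv, hUu, h1v, huv⟩ := generalized_tube_lemma hU
    (isCompact_singleton (x := (1 : G))) ho (by rintro ⟨x, y⟩ ⟨-, rfl⟩; simpa using hε)
  obtain ⟨V, -, hVo, hVv⟩ := exists_isCompact_isOpen_subgroup_subset
    (hv.mem_nhds (h1v rfl))
  refine ⟨V, hVo, fun x hx w hw => ?_⟩
  have h : ‖f (x * w) - f x‖ < ε := huv (Set.mk_mem_prod (hUu hx) (hVv hw))
  exact h.le

variable [IsUltrametricDist K]

/-- Once `U` contains the translating elements occurring in `d`, averages over `U ⧸ W` tend to zero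
as `W` shrinks, by uniform continuity on the compact `U`. -/
theorem exists_tendsto_cosetAverage {S : Set (Subgroup G)} (hdir : DirectedOn (· ≤ ·) S)
    (hS : ∀ U ∈ S, IsCompact (U : Set G) ∧ IsOpen (U : Set G)) (hcov : ∀ g, ∃ U ∈ S, g ∈ U) {C : ℝ}
    (hC : ∀ V U : Subgroup G, IsOpen (V : Set G) → IsOpen (U : Set G) → V ≤ U →
      V.relIndex U ≠ 0 → 1 ≤ C * ‖(V.relIndex U : K)‖) {d : G →ᵇ K}
    (hd : d ∈ Submodule.span K {h : G →ᵇ K | ∃ g f, h = leftTranslate g f - f}) :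
    ∃ U₀ ∈ S, ∀ U ∈ S, U₀ ≤ U →
      Tendsto (fun W : OpenSubgroup G => cosetAverage U W d) atBot (𝓝 0) := by
  have hrel : ∀ U ∈ S, ∀ W : OpenSubgroup G, (W : Subgroup G).relIndex U ≠ 0 := fun U hU W =>
    Subgroup.relIndex_ne_zero_of_isCompact W.isOpen (hS U hU).1
  induction hd using Submodule.span_induction with
  | mem d hd =>
    obtain ⟨g, f, rfl⟩ := hd
    obtain ⟨U₀, hU₀, hg⟩ := hcov g
    refine ⟨U₀, hU₀, fun U hU hle => ?_⟩
    have hC1 : 1 ≤ C := by simpa using hC ⊤ ⊤ isOpen_univ isOpen_univ le_rfl (by simp)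
    rw [Metric.tendsto_nhds]
    intro ε hε
    obtain ⟨V, hVo, hV⟩ := exists_isOpen_subgroup_norm_mul_sub_le (hS U hU).1 f.continuous
      (ε := ε / (2 * C)) (by positivity)
    filter_upwards [eventually_le_atBot (⟨V, hVo⟩ ⊓ ⟨U, (hS U hU).2⟩ : OpenSubgroup G)] with W hW
    have h1 := norm_cosetAverage_translate_sub_le
      (hC W U W.isOpen (hS U hU).2 (fun w hw => (hW hw).2) (hrel U hU W)) (by positivity)
      (fun x hx w hw => hV x hx w (hW hw).1) (hle hg)
    rw [dist_zero_right]
    refine h1.trans_lt ?_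
    have : C * (ε / (2 * C)) = ε / 2 := by field_simp
    rw [this]
    exact half_lt_self hε
  | zero =>
    obtain ⟨U₀, hU₀, -⟩ := hcov 1
    refine ⟨U₀, hU₀, fun U hU _ => tendsto_const_nhds.congr fun W => ?_⟩
    simp [cosetAverage]
  | add d d' _ _ ih ih' =>
    obtain ⟨U₁, hU₁, h₁⟩ := ih
    obtain ⟨U₂, hU₂, h₂⟩ := ih'
    obtain ⟨U₀, hU₀, hle₁, hle₂⟩ := hdir U₁ hU₁ U₂ hU₂
    refine ⟨U₀, hU₀, fun U hU hle => ?_⟩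
    have := (h₁ U hU (hle₁.trans hle)).add (h₂ U hU (hle₂.trans hle))
    rw [add_zero] at this
    exact this.congr fun W => (cosetAverage_add (hrel U hU W) d d').symm
  | smul c d _ ih =>
    obtain ⟨U₀, hU₀, h₀⟩ := ih
    refine ⟨U₀, hU₀, fun U hU hle => ?_⟩
    have := (h₀ U hU hle).const_mul c
    rw [mul_zero] at this
    exact this.congr fun W => (cosetAverage_mul U W c d).symm

/-- The averages of `d + c` tend to `c`, and each is at most `C * ‖d + c‖`. -/
theorem norm_le_mul_norm_add_const {S : Set (Subgroup G)} (hdir : DirectedOn (· ≤ ·) S)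
    (hS : ∀ U ∈ S, IsCompact (U : Set G) ∧ IsOpen (U : Set G)) (hcov : ∀ g, ∃ U ∈ S, g ∈ U) {C : ℝ}
    (hC : ∀ V U : Subgroup G, IsOpen (V : Set G) → IsOpen (U : Set G) → V ≤ U →
      V.relIndex U ≠ 0 → 1 ≤ C * ‖(V.relIndex U : K)‖) {d : G →ᵇ K}
    (hd : d ∈ Submodule.span K {h : G →ᵇ K | ∃ g f, h = leftTranslate g f - f}) (c : K) :
    ‖c‖ ≤ C * ‖d + const G c‖ := by
  obtain ⟨U, hU, hlim⟩ := exists_tendsto_cosetAverage hdir hS hcov hC hd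
  have hlim := hlim U hU le_rfl
  have hlim' := (hlim.add_const c).norm
  rw [zero_add] at hlim'
  refine le_of_tendsto hlim' ?_
  filter_upwards [eventually_le_atBot (⟨U, (hS U hU).2⟩ : OpenSubgroup G)] with W hW
  have hrel := Subgroup.relIndex_ne_zero_of_isCompact W.isOpen (hS U hU).1
  have h1 := hC W U W.isOpen (hS U hU).2 hW hrel
  have h2 : ((W : Subgroup G).relIndex U : K) ≠ 0 := by
    intro h0
    rw [h0, norm_zero, mul_zero] at h1
    exact absurd h1 (by norm_num)
  nth_rewrite 1 [← cosetAverage_const h2 c]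
  rw [← cosetAverage_add hrel]
  exact norm_inv_mul_finsum_le h1 (norm_nonneg _) fun q => (d + const G c).norm_coe_le_norm _

theorem IsLocallyElliptic.exists_isInvariantNormedMean (hK : IsSphericallyComplete K)
    (hG : IsLocallyElliptic G) {C : ℝ}
    (hC : ∀ V U : Subgroup G, IsOpen (V : Set G) → IsOpen (U : Set G) → V ≤ U →
      V.relIndex U ≠ 0 → 1 ≤ C * ‖(V.relIndex U : K)‖) :
    ∃ m : (G →ᵇ K) →ₗ[K] K, IsInvariantNormedMean m ∧ ∀ f, ‖m f‖ ≤ C * ‖f‖ := by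
  obtain ⟨S, hdir, hS, hcov⟩ := hG
  have hC1 : 1 ≤ C := by simpa using hC ⊤ ⊤ isOpen_univ isOpen_univ le_rfl (by simp)
  have hC0 : 0 ≤ C := zero_le_one.trans hC1
  set D : Submodule K (G →ᵇ K) := Submodule.span K {h | ∃ g f, h = leftTranslate g f - f}
  have h1D : const G (1 : K) ∉ D := fun h => by
    have := norm_le_mul_norm_add_const hdir hS hcov hC h (-1)
    have h0 : const G (1 : K) + const G (-1) = 0 := by ext; simp
    rw [h0, norm_zero, mul_zero, norm_neg, norm_one] at this
    exact absurd this (by norm_num)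
  let p : (G →ᵇ K) →ₗ.[K] K := ⟨D, 0⟩
  -- Extend the functional that is 0 on `D` and 1 at the constant `1`, dominated by `C * ‖f‖`.
  obtain ⟨m, hmp, hm⟩ := (p.supSpanSingleton (const G 1) 1 h1D).exists_extend_of_norm_le hK
    (fun f => C * ‖f‖) (fun f => by positivity) (fun c f => by rw [norm_smul]; ring)
    (fun f g => by
      rw [← mul_max_of_nonneg _ _ hC0]
      refine mul_le_mul_of_nonneg_left ((norm_le (by positivity)).2 fun x => ?_) hC0
      exact (IsUltrametricDist.norm_add_le_max _ _).trans
        (max_le_max (f.norm_coe_le_norm x) (g.norm_coe_le_norm x)))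
    (by
      rintro ⟨z, hz⟩
      rcases Submodule.mem_sup.1 hz with ⟨x, hx, y', hy', rfl⟩
      rcases Submodule.mem_span_singleton.1 hy' with ⟨c, rfl⟩
      rw [LinearPMap.supSpanSingleton_apply_mk _ _ _ _ _ hx]
      have := norm_le_mul_norm_add_const hdir hS hcov hC hx c
      have h0 : const G c = c • const G (1 : K) := by ext; simp
      rw [h0] at this
      simpa [p] using this)
  have hmD : ∀ d ∈ D, m d = 0 := fun d hd => by
    refine (hmp ⟨d, Submodule.mem_sup_left hd⟩).trans ?_
    exact LinearPMap.supSpanSingleton_apply_mk_of_mem p 1 h1D hd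
  refine ⟨m, ⟨⟨C, hC0, hm⟩, ?_, fun g f => ?_⟩, hm⟩
  · exact (hmp ⟨_, Submodule.mem_sup_right (Submodule.mem_span_singleton_self _)⟩).trans
      (LinearPMap.supSpanSingleton_apply_self p 1 h1D)
  · rw [← sub_eq_zero, ← map_sub]
    exact hmD _ (Submodule.subset_span ⟨g, f, rfl⟩)

/-- A totally disconnected locally compact group has an invariant mean of norm at most `C` over a
spherically complete field iff it is locally elliptic and its finite indices have norm at least
`C⁻¹`. -/
theorem exists_isInvariantNormedMean_iff (hK : IsSphericallyComplete K) {C : ℝ} :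
    (∃ m : (G →ᵇ K) →ₗ[K] K, IsInvariantNormedMean m ∧ ∀ f, ‖m f‖ ≤ C * ‖f‖) ↔
      IsLocallyElliptic G ∧ ∀ V U : Subgroup G, IsOpen (V : Set G) → IsOpen (U : Set G) → V ≤ U →
        V.relIndex U ≠ 0 → 1 ≤ C * ‖(V.relIndex U : K)‖ := by
  refine ⟨fun ⟨m, hm, hmC⟩ => ⟨hm.isLocallyElliptic, fun V U hV _ hVU h0 => ?_⟩,
    fun h => h.1.exists_isInvariantNormedMean hK h.2⟩
  have hC0 : 0 ≤ C := by
    have := (norm_nonneg _).trans (hmC (const G 1))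
    rwa [norm_const_eq, norm_one, mul_one] at this
  exact hm.one_le_mul_norm_relIndex hC0 hmC hV hVU h0

theorem isNormedAmenable_iff (hK : IsSphericallyComplete K) :
    IsNormedAmenable K G ↔ IsLocallyElliptic G ∧ ∃ C : ℝ, ∀ V U : Subgroup G, IsOpen (V : Set G) →
      IsOpen (U : Set G) → V ≤ U → V.relIndex U ≠ 0 → 1 ≤ C * ‖(V.relIndex U : K)‖ := by
  constructor
  · rintro ⟨m, hm⟩
    obtain ⟨C, -, hC⟩ := hm.bounded
    obtain ⟨h1, h2⟩ := (exists_isInvariantNormedMean_iff hK).1 ⟨m, hm, hC⟩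
    exact ⟨h1, C, h2⟩
  · rintro ⟨h1, C, h2⟩
    obtain ⟨m, hm, -⟩ := (exists_isInvariantNormedMean_iff hK).2 ⟨h1, h2⟩
    exact ⟨m, hm⟩

theorem amenabilityNorm_eq_iInf_relIndex (hK : IsSphericallyComplete K) :
    amenabilityNorm K G = ⨅ (C : ℝ) (_ : IsLocallyElliptic G ∧ ∀ V U : Subgroup G,
      IsOpen (V : Set G) → IsOpen (U : Set G) → V ≤ U → V.relIndex U ≠ 0 →
        1 ≤ C * ‖(V.relIndex U : K)‖), ENNReal.ofReal C := by
  rw [amenabilityNorm_eq_iInf]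
  simp only [exists_isInvariantNormedMean_iff hK]

end Existence

/-! ### Spherical completeness of the closure of the prime field. -/

section SphericalCompleteness

open Topology Filter

theorem IsSphericallyComplete.completeSpace {X : Type*} [PseudoMetricSpace X] [IsUltrametricDist X]
    (hX : IsSphericallyComplete X) : CompleteSpace X := by
  refine Metric.complete_of_convergent_controlled_sequences (fun n => (1 / 2 : ℝ) ^ n)
    (fun n => by positivity) fun u hu => ?_
  obtain ⟨a, ha⟩ := hX u (fun n => (1 / 2 : ℝ) ^ n) (fun n => by positivity)
    (antitone_nat_of_succ_le fun n x hx => by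
      rw [Metric.mem_closedBall] at hx ⊢
      refine (dist_triangle_max _ (u (n + 1)) _).trans (max_le (hx.trans ?_) ?_)
      · exact pow_le_pow_of_le_one (by norm_num) (by norm_num) n.le_succ
      · exact (hu n _ _ n.le_succ le_rfl).le)
  refine ⟨a, tendsto_iff_dist_tendsto_zero.2 (squeeze_zero (fun _ => dist_nonneg)
    (fun n => ?_) (tendsto_pow_atTop_nhds_zero_of_lt_one (r := (1 / 2 : ℝ)) (by norm_num)
      (by norm_num)))⟩
  rw [dist_comm]
  exact Set.mem_iInter.1 ha n

theorem isSphericallyComplete_of_strictAnti_tendsto_zero {X : Type*} [PseudoMetricSpace X]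
    [IsUltrametricDist X] [CompleteSpace X]
    (h : ∀ s : ℕ → ℝ, StrictAnti s → (∀ n, ∃ x y : X, s n = dist x y) → Tendsto s atTop (𝓝 0)) :
    IsSphericallyComplete X := by
  intro c r hr hanti
  by_contra hempty
  have hc : ∀ n m, n ≤ m → c m ∈ Metric.closedBall (c n) (r n) := fun n m hnm =>
    hanti hnm (Metric.mem_closedBall_self (hr m).le)
  -- With empty intersection, every centre is left out by some later ball. Iterating gives strictly
  -- decreasing successive distances, hence a Cauchy sequence of centres, whose limit lies in all
  -- balls.
  have hex : ∀ n, ∃ m, n < m ∧ r m < dist (c n) (c m) := by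
    intro n
    by_contra! hn
    refine hempty ⟨c n, Set.mem_iInter.2 fun m => ?_⟩
    rcases lt_or_ge n m with h1 | h1
    · exact hn m h1
    · exact hc m n h1
  choose j hj hjr using hex
  let k : ℕ → ℕ := fun i => j^[i] 0
  have hk : ∀ i, k (i + 1) = j (k i) := fun i => Function.iterate_succ_apply' j i 0
  have hkmono : StrictMono k := strictMono_nat_of_lt_succ fun i => by rw [hk]; exact hj _
  have hs : StrictAnti fun i => dist (c (k i)) (c (k (i + 1))) :=
    strictAnti_nat_of_succ_lt fun i => by
      refine lt_of_le_of_lt ?_ (by rw [hk i]; exact hjr (k i))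
      rw [hk i, dist_comm]
      exact hc _ _ ((hk i).symm.trans_le (hkmono.monotone (i + 1).le_succ))
  have hlim := h _ hs fun i => ⟨_, _, rfl⟩
  have hcau : CauchySeq fun i => c (k i) := by
    refine Metric.cauchySeq_iff'.2 fun ε hε => ?_
    obtain ⟨N, hN⟩ := (hlim.eventually_lt_const hε).exists
    refine ⟨N, fun n hn => ?_⟩
    induction n, hn using Nat.le_induction with
    | base => simpa using hε
    | succ n hn ih =>
      refine (dist_triangle_max _ (c (k n)) _).trans_lt (max_lt ?_ ih)
      rw [dist_comm]
      exact (hs.antitone hn).trans_lt hN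
  obtain ⟨a, ha⟩ := cauchySeq_tendsto_of_complete hcau
  refine hempty ⟨a, Set.mem_iInter.2 fun n => ?_⟩
  refine Metric.isClosed_closedBall.mem_of_tendsto ha ?_
  filter_upwards [eventually_ge_atTop n] with i hi
  exact hc n _ (hi.trans hkmono.le_apply)

theorem tendsto_zero_of_strictAnti_of_eq_zpow {t : ℝ} (ht0 : 0 < t) (ht1 : t ≤ 1) {s : ℕ → ℝ}
    (hs : StrictAnti s) (h : ∀ n, ∃ k : ℤ, s n = t ^ k) : Tendsto s atTop (𝓝 0) := by
  choose k hk using h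
  have hlt : t < 1 := by
    refine ht1.lt_of_ne fun h1 => ?_
    have := hs zero_lt_one
    simp [hk, h1] at this
  have hkmono : ∀ n, k n < k (n + 1) := fun n => by
    have := hs n.lt_succ_self
    rw [hk, hk] at this
    exact (zpow_lt_zpow_iff_right_of_lt_one₀ ht0 hlt).1 this
  have hkle : ∀ n : ℕ, k 0 + n ≤ k n := by
    intro n
    induction n with
    | zero => simp
    | succ n ih => have := hkmono n; push_cast; omega
  have hlim := (tendsto_pow_atTop_nhds_zero_of_lt_one ht0.le hlt).const_mul (t ^ k 0)
  rw [mul_zero] at hlim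
  refine squeeze_zero (fun n => ?_) (fun n => ?_) hlim
  · rw [hk]; positivity
  · rw [hk, ← zpow_natCast, ← zpow_add₀ ht0.ne']
    exact zpow_le_zpow_right_of_le_one₀ ht0 ht1 (hkle n)

variable {K : Type*} [NormedField K] [IsUltrametricDist K]

theorem norm_natCast_eq_one_of_coprime {p n : ℕ} (hp : ‖(p : K)‖ < 1) (h : p.Coprime n) :
    ‖(n : K)‖ = 1 := by
  refine le_antisymm (IsUltrametricDist.norm_natCast_le_one K n) ?_
  by_contra! hn
  have h1 := congrArg (Int.cast : ℤ → K) (Nat.gcd_eq_gcd_ab p n)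
  rw [h.gcd_eq_one] at h1
  push_cast at h1
  have h2 : ∀ (x : K) (z : ℤ), ‖x‖ < 1 → ‖x * z‖ < 1 := fun x z hx => by
    rw [norm_mul]
    exact (mul_le_of_le_one_right (norm_nonneg _)
      (IsUltrametricDist.norm_intCast_le_one K z)).trans_lt hx
  have h3 : ‖(1 : K)‖ < 1 := by
    rw [h1]
    exact (IsUltrametricDist.norm_add_le_max _ _).trans_lt (max_lt (h2 _ _ hp) (h2 _ _ hn))
  simp at h3

theorem norm_natCast_eq_pow_factorization {p : ℕ} (hp : p.Prime) (hpK : ‖(p : K)‖ < 1) {n : ℕ}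
    (hn : n ≠ 0) : ‖(n : K)‖ = ‖(p : K)‖ ^ n.factorization p := by
  nth_rewrite 1 [← Nat.ordProj_mul_ordCompl_eq_self n p]
  rw [Nat.cast_mul, norm_mul, norm_natCast_eq_one_of_coprime hpK (Nat.coprime_ordCompl hp hn),
    Nat.cast_pow, norm_pow, mul_one]

-- If some prime has norm below 1 and is nonzero in `K`, its norm serves as `t`; otherwise nonzero
-- naturals have norm 1 and `t = 1`.
variable (K) in
theorem exists_norm_natCast_eq_zpow : ∃ t : ℝ, 0 < t ∧ t ≤ 1 ∧
    ∀ n : ℕ, (n : K) ≠ 0 → ∃ k : ℤ, ‖(n : K)‖ = t ^ k := by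
  by_cases h : ∃ p : ℕ, p.Prime ∧ ‖(p : K)‖ < 1
  · obtain ⟨p, hp, hpK⟩ := h
    by_cases h0 : (p : K) = 0
    · refine ⟨1, one_pos, le_rfl, fun n hn => ⟨0, ?_⟩⟩
      rw [zpow_zero]
      refine norm_natCast_eq_one_of_coprime hpK ((Nat.Prime.coprime_iff_not_dvd hp).2 ?_)
      rintro ⟨m, rfl⟩
      simp [h0] at hn
    · refine ⟨‖(p : K)‖, norm_pos_iff.2 h0, hpK.le, fun n hn => ⟨n.factorization p, ?_⟩⟩
      rw [zpow_natCast]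
      exact norm_natCast_eq_pow_factorization hp hpK (by rintro rfl; simp at hn)
  · push Not at h
    exact ⟨1, one_pos, le_rfl, fun n hn => ⟨0, by
      rw [zpow_zero]
      exact norm_natCast_eq_one_of_forall_prime h (by rintro rfl; simp at hn)⟩⟩

variable (K) in
theorem exists_norm_primeFieldClosure_eq_zpow : ∃ t : ℝ, 0 < t ∧ t ≤ 1 ∧
    ∀ x : primeFieldClosure K, x ≠ 0 → ∃ k : ℤ, ‖x‖ = t ^ k := by
  obtain ⟨t, ht0, ht1, ht⟩ := exists_norm_natCast_eq_zpow K
  have hint : ∀ z : ℤ, (z : K) ≠ 0 → ∃ k : ℤ, ‖(z : K)‖ = t ^ k := fun z hz => by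
    obtain ⟨n, rfl | rfl⟩ := z.eq_nat_or_neg
    · simpa using ht n (by simpa using hz)
    · simpa using ht n (by simpa using hz)
  have hbot : ∀ x ∈ (⊥ : Subfield K), ∃ a b : ℤ, (b : K) ≠ 0 ∧ x = a / b := by
    intro x hx
    rw [← Subfield.closure_empty] at hx
    induction hx using Subfield.closure_induction with
    | mem x hx => exact absurd hx (Set.notMem_empty x)
    | one => exact ⟨1, 1, by simp, by simp⟩
    | add x y _ _ ihx ihy =>
      obtain ⟨a, b, hb, rfl⟩ := ihx
      obtain ⟨a', b', hb', rfl⟩ := ihy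
      exact ⟨a * b' + b * a', b * b', by push_cast; exact mul_ne_zero hb hb', by
        rw [div_add_div _ _ hb hb']; push_cast; rfl⟩
    | neg x _ ihx =>
      obtain ⟨a, b, hb, rfl⟩ := ihx
      exact ⟨-a, b, hb, by push_cast; ring⟩
    | inv x _ ihx =>
      obtain ⟨a, b, hb, rfl⟩ := ihx
      by_cases ha : (a : K) = 0
      · exact ⟨0, 1, by simp, by simp [ha]⟩
      · exact ⟨b, a, ha, by rw [inv_div]⟩
    | mul x y _ _ ihx ihy =>
      obtain ⟨a, b, hb, rfl⟩ := ihx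
      obtain ⟨a', b', hb', rfl⟩ := ihy
      exact ⟨a * a', b * b', by push_cast; exact mul_ne_zero hb hb', by
        push_cast; rw [div_mul_div_comm]⟩
  refine ⟨t, ht0, ht1, fun x hx => ?_⟩
  have hx0 : 0 < ‖(x : K)‖ := norm_pos_iff.2 (by simpa using hx)
  obtain ⟨y, hy, hxy⟩ := Metric.mem_closure_iff.1 x.2 _ hx0
  -- Passing to the closure adds no new values: `y` is nearer to `x` than `‖x‖`.
  have hnorm : ‖(x : K)‖ = ‖y‖ := by
    rw [dist_eq_norm] at hxy
    rw [← norm_neg y]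
    refine IsUltrametricDist.norm_eq_of_add_norm_lt_max ?_
    rw [← sub_eq_add_neg]
    exact lt_max_of_lt_left hxy
  obtain ⟨a, b, hb, rfl⟩ := hbot y hy
  have ha : (a : K) ≠ 0 := by
    rintro ha
    rw [ha, zero_div, norm_zero] at hnorm
    exact hx0.ne' hnorm
  obtain ⟨k, hk⟩ := hint a ha
  obtain ⟨l, hl⟩ := hint b hb
  refine ⟨k - l, ?_⟩
  rw [zpow_sub₀ ht0.ne', ← hk, ← hl, ← norm_div, ← hnorm]
  rfl

theorem IsSphericallyComplete.primeFieldClosure (hK : IsSphericallyComplete K) :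
    IsSphericallyComplete (primeFieldClosure K) := by
  have := hK.completeSpace
  have : CompleteSpace (_root_.primeFieldClosure K) :=
    (Subfield.isClosed_topologicalClosure _).completeSpace_coe
  obtain ⟨t, ht0, ht1, ht⟩ := exists_norm_primeFieldClosure_eq_zpow K
  refine isSphericallyComplete_of_strictAnti_tendsto_zero fun s hs hd =>
    tendsto_zero_of_strictAnti_of_eq_zpow ht0 ht1 hs fun n => ?_
  obtain ⟨x, y, hxy⟩ := hd n
  obtain ⟨x', y', hxy'⟩ := hd (n + 1)
  -- Positivity comes from the next, strictly smaller, distance.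
  have hpos : 0 < s n := (dist_nonneg.trans_eq hxy'.symm).trans_lt (hs n.lt_succ_self)
  rw [dist_eq_norm] at hxy
  rw [hxy] at hpos ⊢
  exact ht _ (norm_pos_iff.1 hpos)

end SphericalCompleteness

/-! ### Arithmetic of the index condition in the three cases. -/

section Main

open Topology Filter

theorem norm_prime_lt_one_of_padic {K : Type*} [NormedField K] {p : ℕ} [Fact p.Prime]
    (e : K ≃+* ℚ_[p])
    (he : Continuous e.symm) : (p : K) ≠ 0 ∧ ‖(p : K)‖ < 1 := by
  refine ⟨fun h => ?_, ?_⟩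
  · have := congrArg e h
    simp [(Fact.out : p.Prime).ne_zero] at this
  · have hlim := (he.tendsto 0).comp
      (tendsto_pow_atTop_nhds_zero_of_norm_lt_one (Padic.norm_p_lt_one (p := p)))
    have hlim' := hlim.norm
    simp only [Function.comp_def, map_pow, map_natCast, map_zero, norm_zero, norm_pow] at hlim'
    by_contra! h1
    exact absurd (ge_of_tendsto' hlim' fun n => one_le_pow₀ h1) (by norm_num)

variable {K : Type*} [NormedField K] [IsUltrametricDist K]

theorem pow_dvd_iff_norm_natCast_le {p : ℕ} (hp : p.Prime) (hp0 : (p : K) ≠ 0)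
    (hpK : ‖(p : K)‖ < 1) {n : ℕ} (hn : n ≠ 0) (k : ℕ) :
    p ^ k ∣ n ↔ ‖(n : K)‖ ≤ ‖(p : K)‖ ^ k := by
  rw [norm_natCast_eq_pow_factorization hp hpK hn,
    pow_le_pow_iff_right_of_lt_one₀ (norm_pos_iff.2 hp0) hpK, hp.pow_dvd_iff_le_factorization hn]

theorem not_pow_succ_dvd_iff_le_norm_natCast {p : ℕ} (hp : p.Prime) (hp0 : (p : K) ≠ 0)
    (hpK : ‖(p : K)‖ < 1) {n : ℕ} (hn : n ≠ 0) (k : ℕ) :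
    ¬ p ^ (k + 1) ∣ n ↔ 1 ≤ (‖(p : K)‖ ^ k)⁻¹ * ‖(n : K)‖ := by
  rw [← div_eq_inv_mul, one_le_div (pow_pos (norm_pos_iff.2 hp0) k),
    norm_natCast_eq_pow_factorization hp hpK hn,
    pow_le_pow_iff_right_of_lt_one₀ (norm_pos_iff.2 hp0) hpK, hp.pow_dvd_iff_le_factorization hn,
    not_le, Nat.lt_succ_iff]

variable {G : Type*} [Group G] [TopologicalSpace G] [IsTopologicalGroup G] [T2Space G]
  [LocallyCompactSpace G] [TotallyDisconnectedSpace G]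

theorem isAmenableOfNorm_one (hK : IsSphericallyComplete K) (hG : IsLocallyElliptic G)
    (h : ∀ V U : Subgroup G, IsOpen (V : Set G) → IsOpen (U : Set G) → V ≤ U →
      V.relIndex U ≠ 0 → ‖(V.relIndex U : K)‖ = 1) : IsAmenableOfNorm K G 1 := by
  refine ⟨(isNormedAmenable_iff hK).2 ⟨hG, 1, fun V U hV hU hVU h0 => by
    rw [h V U hV hU hVU h0, mul_one]⟩, ?_⟩
  rw [amenabilityNorm_eq_iInf_relIndex hK]
  refine le_antisymm (iInf₂_le_of_le 1 ⟨hG, fun V U hV hU hVU h0 => ?_⟩ (by simp))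
    (le_iInf₂ fun C hC => ?_)
  · rw [h V U hV hU hVU h0, mul_one]
  · rw [ENNReal.one_le_ofReal]
    simpa using hC.2 ⊤ ⊤ isOpen_univ isOpen_univ le_rfl (by simp)

theorem isNormedAmenable_primeFieldClosure_iff (hK : IsSphericallyComplete K) :
    IsNormedAmenable K G ↔ IsNormedAmenable (primeFieldClosure K) G := by
  rw [isNormedAmenable_iff hK, isNormedAmenable_iff hK.primeFieldClosure]
  -- Both criteria involve only norms of natural numbers, and the subfield norm is the restricted
  -- one.
  rfl

theorem amenabilityNorm_primeFieldClosure (hK : IsSphericallyComplete K) :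
    amenabilityNorm K G = amenabilityNorm (primeFieldClosure K) G := by
  rw [amenabilityNorm_eq_iInf_relIndex hK, amenabilityNorm_eq_iInf_relIndex hK.primeFieldClosure]
  rfl

theorem isNormedAmenable_iff_of_natCast_eq_zero (hK : IsSphericallyComplete K) {p : ℕ}
    (hp : p.Prime) (hpK : (p : K) = 0) :
    (IsNormedAmenable K G ↔ IsAmenableOfNorm K G 1) ∧
      (IsNormedAmenable K G ↔ IsLocallyElliptic G ∧ IsIndexFree p G) := by
  have h1 : IsNormedAmenable K G → IsLocallyElliptic G ∧ IsIndexFree p G := fun h => by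
    obtain ⟨hG, C, hC⟩ := (isNormedAmenable_iff hK).1 h
    refine ⟨hG, fun V U hV hU hVU h0 hdvd => ?_⟩
    obtain ⟨c, hc⟩ := hdvd
    have := hC V U hV hU hVU h0
    rw [hc, Nat.cast_mul, hpK, zero_mul, norm_zero, mul_zero] at this
    exact absurd this (by norm_num)
  have h2 : IsLocallyElliptic G ∧ IsIndexFree p G → IsAmenableOfNorm K G 1 := fun h =>
    isAmenableOfNorm_one hK h.1 fun V U hV hU hVU h0 =>
      norm_natCast_eq_one_of_coprime (p := p) (by simp [hpK])
        (hp.coprime_iff_not_dvd.2 (h.2 V U hV hU hVU h0))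
  exact ⟨⟨fun h => h2 (h1 h), fun h => h.1⟩, ⟨h1, fun h => (h2 h).1⟩⟩

theorem isNormedAmenable_iff_of_norm_natCast_eq_one (hK : IsSphericallyComplete K)
    (h : ∀ n : ℕ, n ≠ 0 → ‖(n : K)‖ = 1) :
    (IsNormedAmenable K G ↔ IsAmenableOfNorm K G 1) ∧
      (IsNormedAmenable K G ↔ IsLocallyElliptic G) := by
  have h1 : IsNormedAmenable K G → IsLocallyElliptic G := fun h =>
    ((isNormedAmenable_iff hK).1 h).1
  have h2 : IsLocallyElliptic G → IsAmenableOfNorm K G 1 := fun hG =>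
    isAmenableOfNorm_one hK hG fun V U _ _ _ h0 => h _ h0
  exact ⟨⟨fun h => h2 (h1 h), fun h => h.1⟩, ⟨h1, fun h => (h2 h).1⟩⟩

theorem isNormedAmenable_iff_isPowIndexFree (hK : IsSphericallyComplete K) {p : ℕ}
    (hp : p.Prime) (hp0 : (p : K) ≠ 0) (hpK : ‖(p : K)‖ < 1) :
    IsNormedAmenable K G ↔ IsLocallyElliptic G ∧ IsPowIndexFree p G := by
  rw [isNormedAmenable_iff hK]
  refine and_congr_right fun _ => ⟨fun ⟨C, hC⟩ => ?_, fun ⟨k, hk, hfree⟩ => ?_⟩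
  · have hC1 : 1 ≤ C := by simpa using hC ⊤ ⊤ isOpen_univ isOpen_univ le_rfl (by simp)
    have hlim := (tendsto_pow_atTop_nhds_zero_of_lt_one (norm_nonneg _) hpK).const_mul C
    rw [mul_zero] at hlim
    -- With `C * ‖p‖ ^ k < 1`, an index divisible by `p ^ k` would violate the bound.
    obtain ⟨k, hk, hk1⟩ := ((hlim.eventually_lt_const one_pos).and (eventually_ge_atTop 1)).exists
    refine ⟨k, hk1, fun V U hV hU hVU h0 hdvd => hk.not_ge ?_⟩
    exact (hC V U hV hU hVU h0).trans (mul_le_mul_of_nonneg_left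
      ((pow_dvd_iff_norm_natCast_le hp hp0 hpK h0 k).1 hdvd) (zero_le_one.trans hC1))
  · obtain ⟨k, rfl⟩ := Nat.exists_eq_add_of_le' hk
    exact ⟨_, fun V U hV hU hVU h0 =>
      (not_pow_succ_dvd_iff_le_norm_natCast hp hp0 hpK h0 k).1 (hfree V U hV hU hVU h0)⟩

theorem isLeast_amenabilityNorm (hK : IsSphericallyComplete K) {p : ℕ} (hp : p.Prime)
    (hpK : ‖(p : K)‖ = (p : ℝ)⁻¹) (h : IsNormedAmenable K G) :
    IsLeast {c : ℝ≥0∞ | ∃ k : ℕ, c = (p : ℝ≥0∞) ^ k ∧ IsIndexFree (p ^ (k + 1)) G}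
      (amenabilityNorm K G) := by
  classical
  have hppos : (0 : ℝ) < p := by exact_mod_cast hp.pos
  have hp1 : ‖(p : K)‖ < 1 := by
    rw [hpK]
    exact inv_lt_one_of_one_lt₀ (by exact_mod_cast hp.one_lt)
  have hp0 : (p : K) ≠ 0 := norm_pos_iff.1 (by rw [hpK]; positivity)
  obtain ⟨hG, k, hk1, hk⟩ := (isNormedAmenable_iff_isPowIndexFree hK hp hp0 hp1).1 h
  have hex : ∃ k, IsIndexFree (p ^ (k + 1)) G := ⟨k - 1, by rwa [Nat.sub_add_cancel hk1]⟩
  obtain ⟨k₀, hspec, hmin⟩ : ∃ k₀, IsIndexFree (p ^ (k₀ + 1)) G ∧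
      ∀ j < k₀, ¬ IsIndexFree (p ^ (j + 1)) G :=
    ⟨Nat.find hex, Nat.find_spec hex, fun j => Nat.find_min hex⟩
  have hpow : ∀ j, (‖(p : K)‖ ^ j)⁻¹ = (p : ℝ) ^ j := fun j => by rw [hpK, inv_pow, inv_inv]
  have hnorm : amenabilityNorm K G = (p : ℝ≥0∞) ^ k₀ := by
    have hcast : (p : ℝ≥0∞) ^ k₀ = ENNReal.ofReal ((p : ℝ) ^ k₀) := by
      rw [ENNReal.ofReal_pow hppos.le, ENNReal.ofReal_natCast]
    rw [amenabilityNorm_eq_iInf_relIndex hK, hcast]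
    refine le_antisymm (iInf₂_le_of_le ((p : ℝ) ^ k₀) ⟨hG, fun V U hV hU hVU h0 => ?_⟩ le_rfl)
      (le_iInf₂ fun C hC => ENNReal.ofReal_le_ofReal ?_)
    · rw [← hpow]
      exact (not_pow_succ_dvd_iff_le_norm_natCast hp hp0 hp1 h0 k₀).1
        (hspec V U hV hU hVU h0)
    · have hC1 : 1 ≤ C := by simpa using hC.2 ⊤ ⊤ isOpen_univ isOpen_univ le_rfl (by simp)
      rcases Nat.eq_zero_or_pos k₀ with h0 | hpos
      · rwa [h0, pow_zero]
      -- Minimality of `k₀` supplies an index divisible by `p ^ k₀`, which forces `C ≥ p ^ k₀`.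
      · have hnot := hmin _ (Nat.sub_lt hpos one_pos)
        rw [show k₀ - 1 + 1 = k₀ from Nat.sub_add_cancel hpos] at hnot
        simp only [IsIndexFree, not_forall, not_not] at hnot
        obtain ⟨V, U, hV, hU, hVU, h0, hdvd⟩ := hnot
        have h1 := (hC.2 V U hV hU hVU h0).trans (mul_le_mul_of_nonneg_left
          ((pow_dvd_iff_norm_natCast_le hp hp0 hp1 h0 k₀).1 hdvd) (zero_le_one.trans hC1))
        rw [← hpow]
        exact (inv_le_iff_one_le_mul₀ (pow_pos (norm_pos_iff.2 hp0) _)).2 h1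
  rw [hnorm]
  refine ⟨⟨k₀, rfl, hspec⟩, ?_⟩
  rintro _ ⟨j, rfl, hj⟩
  exact pow_le_pow_right₀ (by exact_mod_cast hp.one_lt.le) (not_lt.1 fun hlt => hmin j hlt hj)

end Main

theorem mainTheorem3
    (G : Type*) [Group G] [TopologicalSpace G] [IsTopologicalGroup G] [T2Space G]
    [LocallyCompactSpace G] [TotallyDisconnectedSpace G]
    (K : Type*) [NormedField K] [IsUltrametricDist K] (hK : IsSphericallyComplete K) :
    -- amenability over `K` and over the closure of the prime field agree, with the same norm
    ((IsNormedAmenable K G ↔ IsNormedAmenable (primeFieldClosure K) G) ∧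
      amenabilityNorm K G = amenabilityNorm (primeFieldClosure K) G) ∧
    -- the closure of the prime field is `𝔽_p`
    (∀ (p : ℕ) [Fact p.Prime], Nonempty (primeFieldClosure K ≃+* ZMod p) →
      (IsNormedAmenable K G ↔ IsAmenableOfNorm K G 1) ∧
      (IsNormedAmenable K G ↔ IsLocallyElliptic G ∧ IsIndexFree p G)) ∧
    -- the closure of the prime field is `ℚ`, trivially valued
    (Nonempty (primeFieldClosure K ≃+* ℚ) → (∀ x : primeFieldClosure K, x ≠ 0 → ‖x‖ = 1) →
      (IsNormedAmenable K G ↔ IsAmenableOfNorm K G 1) ∧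
      (IsNormedAmenable K G ↔ IsLocallyElliptic G)) ∧
    -- the closure of the prime field is `ℚ_p`; the norm formula is for the normalization
    -- in which `p` has norm `p⁻¹`
    (∀ (p : ℕ) [Fact p.Prime],
      (∃ e : primeFieldClosure K ≃+* ℚ_[p], Continuous e ∧ Continuous e.symm) →
      (IsNormedAmenable K G ↔ IsLocallyElliptic G ∧ IsPowIndexFree p G) ∧
      (‖(p : K)‖ = (p : ℝ)⁻¹ → IsNormedAmenable K G →
        IsLeast {c : ℝ≥0∞ | ∃ k : ℕ, c = (p : ℝ≥0∞) ^ k ∧ IsIndexFree (p ^ (k + 1)) G}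
          (amenabilityNorm K G))) := by

  refine ⟨⟨isNormedAmenable_primeFieldClosure_iff hK, amenabilityNorm_primeFieldClosure hK⟩,
    ?_, ?_, ?_⟩
  · rintro p hp ⟨e⟩
    refine isNormedAmenable_iff_of_natCast_eq_zero hK hp.out ?_
    have h0 : (p : primeFieldClosure K) = 0 := e.injective (by simp)
    exact congrArg Subtype.val h0
  · rintro ⟨e⟩ h
    refine isNormedAmenable_iff_of_norm_natCast_eq_one hK fun n hn => h n fun h0 => hn ?_
    simpa using congrArg e h0
  · rintro p hp ⟨e, -, he⟩
    obtain ⟨hp0, hp1⟩ := norm_prime_lt_one_of_padic e he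
    have hp0' : (p : K) ≠ 0 := fun h => hp0 (Subtype.ext h)
    exact ⟨isNormedAmenable_iff_isPowIndexFree hK hp.out hp0' hp1,
      fun hpK h => isLeast_amenabilityNorm hK hp.out hpK h⟩
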